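/- Let $f(x,y)\in\mathbb{C}\{x,y\}$ be a convergent power series with $0<\operatorname{ord} f(x,0)<\infty$. A fractional power series is a series $\phi(y)=a_1y^{n_1/N}+a_2y^{n_2/N}+\cdots$ with $a_i\in\mathbb{C}$ and positive integers $n_1<n_2<\cdots$ such that $\phi(t^N)$ has positive radius of convergence; $O(\phi,\psi)=\operatorname{ord}(\phi-\psi)$ is the contact order, with $\operatorname{ord} 0=+\infty$. For $p\in\mathbb{C}\{x,y\}$ let $\operatorname{Zer}p$ be the set of fractional power series $\gamma$ with $p(\gamma(y),y)=0$. A pseudo-ball of height $h=h(B)$, where $h$ is a positive rational number or $+\infty$, is a set $B=B(\alpha,h)=\{\gamma : O(\gamma,\alpha)\ge h\}$ of fractional power series. If $h<\infty$, let $\lambda_B$ be $\alpha$ with all terms $y^e$, $e\ge h$, omitted. Then there are a unique nonzero polynomial $F_B\in\mathbb{C}[z]$ and a unique exponent $q(B)\in\mathbb{Q}$ such that $f(\gamma(y),y)=F_B(z)\,y^{q(B)}+\text{(higher order terms)}$ for every $\gamma(y)=\lambda_B(y)+z\,y^{h(B)}+\text{(higher order terms)}$ in $B$; equivalently, $F_B(z)y^{q(B)}$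 is the initial term in $y$ of $f(\lambda_B(y)+zy^{h(B)},y)$, with $z$ an indeterminate. If $h(B)=+\infty$, put $q(B)=+\infty$. Let $T(f)=\{B(\alpha,O(\alpha,\beta)):\alpha,\beta\in\operatorname{Zer}f\}$, a finite tree under inclusion: $B'$ is a child of $B$ if $B'\subsetneq B$ and no element of $T(f)$ lies strictly between them. Pseudo-balls $B,\bar B\in T(f)$ are conjugate if $h(B)=h(\bar B)$ and some irreducible $p\in\mathbb{C}\{x,y\}$ has a root $\gamma\in\operatorname{Zer}p$ in $B$ and a root in $\bar B$; this is an equivalence relation. Let $[B]$ be the conjugacy class of $B$ in $T(f)$. The Eggers tree $E(f)$ is the set of all these classes with the induced tree structure: a class is a child of $[B]$ if one of its elements is a child in $T(f)$ of an element of $[B]$. Let $t([B])$ be the number of children of $[B]$ in $E(f)$. Corollary. If $B\in T(f)$ and $q(B)$ is an integer, then the polynomial $F_B$ has at most $t([B])$ nonzero critical values, that is, there are at most $t([B])$ nonzero numbers $w\in\mathbb{C}$ such that $F_B'(z)=0$ and $F_B(z)=w$ for some $z\in\mathbb{C}$. -/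

import Mathlib

noncomputable section

namespace KuoLu

open Polynomial

/-! ### Convergent power series in two variables -/

/-- A formal power series in `x = X 0`, `y = X 1` is convergent if it converges absolutely on some
polydisc of positive radius. -/
def IsConvergent (f : MvPowerSeries (Fin 2) ℂ) : Prop :=
  ∃ r : ℝ, 0 < r ∧ Summable fun m : Fin 2 →₀ ℕ => ‖MvPowerSeries.coeff m f‖ * r ^ m.degree

theorem IsConvergent.mono {f : MvPowerSeries (Fin 2) ℂ} {r s : ℝ} (hr : 0 < r) (hrs : r ≤ s)
    (h : Summable fun m : Fin 2 →₀ ℕ => ‖MvPowerSeries.coeff m f‖ * s ^ m.degree) :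
    Summable fun m : Fin 2 →₀ ℕ => ‖MvPowerSeries.coeff m f‖ * r ^ m.degree :=
  Summable.of_nonneg_of_le (fun _ => by positivity) (fun _ => by gcongr) h

theorem isConvergent_monomial (m : Fin 2 →₀ ℕ) (a : ℂ) :
    IsConvergent (MvPowerSeries.monomial m a) := by
  classical
  refine ⟨1, one_pos, summable_of_ne_finset_zero (s := {m}) fun n hn => ?_⟩
  rw [MvPowerSeries.coeff_monomial_ne (by simpa using hn)]
  simp

theorem IsConvergent.add {f g : MvPowerSeries (Fin 2) ℂ} (hf : IsConvergent f)
    (hg : IsConvergent g) : IsConvergent (f + g) := by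
  obtain ⟨r, hr, hf⟩ := hf
  obtain ⟨s, hs, hg⟩ := hg
  have ht : 0 < min r s := lt_min hr hs
  refine ⟨min r s, ht, Summable.of_nonneg_of_le (fun _ => by positivity) (fun m => ?_)
    ((IsConvergent.mono ht (min_le_left r s) hf).add (IsConvergent.mono ht (min_le_right r s) hg))⟩
  rw [← add_mul, map_add]
  gcongr
  exact norm_add_le _ _

theorem IsConvergent.neg {f : MvPowerSeries (Fin 2) ℂ} (hf : IsConvergent f) :
    IsConvergent (-f) := by
  obtain ⟨r, hr, hf⟩ := hf
  exact ⟨r, hr, by simpa using hf⟩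

theorem IsConvergent.mul {f g : MvPowerSeries (Fin 2) ℂ} (hf : IsConvergent f)
    (hg : IsConvergent g) : IsConvergent (f * g) := by
  classical
  obtain ⟨r, hr, hf⟩ := hf
  obtain ⟨s, hs, hg⟩ := hg
  have ht : 0 < min r s := lt_min hr hs
  refine ⟨min r s, ht, ?_⟩
  have h1 := IsConvergent.mono ht (min_le_left r s) hf
  have h2 := IsConvergent.mono ht (min_le_right r s) hg
  have h0 : Summable fun p : (Fin 2 →₀ ℕ) × (Fin 2 →₀ ℕ) =>
      (‖MvPowerSeries.coeff p.1 f‖ * min r s ^ p.1.degree) *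
        (‖MvPowerSeries.coeff p.2 g‖ * min r s ^ p.2.degree) :=
    h1.mul_of_nonneg h2 (fun _ => by positivity) (fun _ => by positivity)
  have h3 := summable_sum_mul_antidiagonal_of_summable_mul
    (f := fun m => ‖MvPowerSeries.coeff m f‖ * min r s ^ m.degree)
    (g := fun m => ‖MvPowerSeries.coeff m g‖ * min r s ^ m.degree) h0
  refine Summable.of_nonneg_of_le (fun _ => by positivity) (fun m => ?_) h3
  rw [MvPowerSeries.coeff_mul]
  refine (mul_le_mul_of_nonneg_right (norm_sum_le _ _) (by positivity)).trans ?_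
  rw [Finset.sum_mul]
  refine Finset.sum_le_sum fun k hk => le_of_eq ?_
  have hd : m.degree = k.1.degree + k.2.degree := by
    rw [← Finset.HasAntidiagonal.mem_antidiagonal.1 hk, map_add]
  rw [hd, norm_mul, pow_add]
  ring

/-- The ring `ℂ{x, y}` of convergent power series, with `x = X 0` and `y = X 1`. -/
def convergentSubring : Subring (MvPowerSeries (Fin 2) ℂ) where
  carrier := {f | IsConvergent f}
  zero_mem' := by simpa using isConvergent_monomial 0 0
  one_mem' := isConvergent_monomial 0 1
  add_mem' := IsConvergent.add
  mul_mem' := IsConvergent.mul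
  neg_mem' := IsConvergent.neg

/-- The type `ℂ{x, y}`. -/
abbrev ConvSeries : Type := convergentSubring

/-- The coefficient of `x ^ i * y ^ j` in `f`. -/
def coeffXY (f : ConvSeries) (i j : ℕ) : ℂ :=
  MvPowerSeries.coeff (Finsupp.single 0 i + Finsupp.single 1 j) f.1

/-- The one-variable power series `f(x, 0)`. -/
def restrictX (f : ConvSeries) : PowerSeries ℂ :=
  PowerSeries.mk fun i => coeffXY f i 0

/-! ### Fractional power series -/

/-- `φ = a₁ y^(n₁/N) + a₂ y^(n₂/N) + ⋯` with positive integers `n₁ < n₂ < ⋯` such that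
`φ(t ^ N)` has positive radius of convergence. -/
def IsFractional (φ : HahnSeries ℚ ℂ) : Prop :=
  ∃ N : ℕ, 0 < N ∧ (∀ e ∈ φ.support, ∃ n : ℕ, 0 < n ∧ e = (n : ℚ) / N) ∧
    ∃ r : ℝ, 0 < r ∧ Summable fun n : ℕ => ‖φ.coeff ((n : ℚ) / N)‖ * r ^ n

/-- The type of fractional (convergent) power series. -/
abbrev FracSeries : Type := {φ : HahnSeries ℚ ℂ // IsFractional φ}

/-- The contact order `O(φ, ψ) = ord (φ - ψ)`, equal to `⊤` if `φ = ψ`. -/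
def contact (φ ψ : FracSeries) : WithTop ℚ := (φ.1 - ψ.1).orderTop

theorem FracSeries.pos_of_coeff_ne_zero (φ : FracSeries) {e : ℚ} (he : φ.1.coeff e ≠ 0) :
    0 < e := by
  obtain ⟨N, hN, h, -⟩ := φ.2
  obtain ⟨n, hn, rfl⟩ := h e he
  positivity

theorem orderTop_pos {R : Type*} [Zero R] {φ : HahnSeries ℚ R}
    (h : ∀ e, φ.coeff e ≠ 0 → 0 < e) : 0 < φ.orderTop := by
  rcases eq_or_ne φ 0 with rfl | hφ
  · simp
  · rw [HahnSeries.zero_lt_orderTop_iff hφ]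
    exact h _ (by rwa [← HahnSeries.leadingCoeff_eq, HahnSeries.leadingCoeff_ne_zero])

theorem contact_pos (φ ψ : FracSeries) : 0 < contact φ ψ := by
  refine orderTop_pos fun e he => ?_
  by_contra hneg
  have h1 : φ.1.coeff e = 0 := by_contra fun h => hneg (φ.pos_of_coeff_ne_zero h)
  have h2 : ψ.1.coeff e = 0 := by_contra fun h => hneg (ψ.pos_of_coeff_ne_zero h)
  simp [h1, h2] at he

/-- The substitution `f(φ(y), y) = ∑ f_ij φ(y)^i y^j`, for a series `φ` of positive order in `y`
with coefficients in a commutative `ℂ`-algebra. -/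
def subst {K : Type*} [CommRing K] [Algebra ℂ K] (f : ConvSeries) (φ : HahnSeries ℚ K) :
    HahnSeries ℚ K :=
  (HahnSeries.SummableFamily.smulFamily (fun ij : ℕ × ℕ => coeffXY f ij.1 ij.2)
    ((HahnSeries.SummableFamily.powers φ).mul
      (HahnSeries.SummableFamily.powers (HahnSeries.single (1 : ℚ) (1 : K))))).hsum

/-- The set of Newton-Puiseux roots `x = γ(y)` of `p(x, y)`. -/
def Zer (p : ConvSeries) : Set FracSeries := {γ | subst p γ.1 = 0}

/-! ### Pseudo-balls -/

/-- A pseudo-ball: a set of the form `{γ | O(γ, α) ≥ h}`, where the height `h` is a positive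
rational number or `⊤`. -/
@[ext]
structure PseudoBall where
  carrier : Set FracSeries
  height : WithTop ℚ
  height_pos : 0 < height
  exists_center : ∃ α : FracSeries, carrier = {γ | height ≤ contact γ α}

/-- The pseudo-ball `B(α, h)`. -/
def ball (α : FracSeries) (h : WithTop ℚ) (hh : 0 < h) : PseudoBall :=
  ⟨{γ | h ≤ contact γ α}, h, hh, α, rfl⟩

/-- A center of a pseudo-ball. -/
def PseudoBall.center (B : PseudoBall) : FracSeries := B.exists_center.choose

/-- The series `λ_B`: a center of `B` with all terms `y ^ e`, `e ≥ h(B)`, omitted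
(used only for finite height). -/
def PseudoBall.lam (B : PseudoBall) : HahnSeries ℚ ℂ :=
  HahnSeries.truncLT (B.height.untopD 0) B.center.1

/-- The leading coefficient of `γ` with respect to `B`, that is, the `c` in
`γ = λ_B + c y ^ h(B) + ⋯` (used only for finite height and `γ` in `B`). -/
def PseudoBall.lc (B : PseudoBall) (γ : FracSeries) : ℂ := γ.1.coeff (B.height.untopD 0)

/-- The series `λ_B(y) + z y ^ h(B)` over `ℂ[z]`, with an indeterminate coefficient `z`. -/
def PseudoBall.generic (B : PseudoBall) : HahnSeries ℚ ℂ[X] :=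
  B.lam.map (C : ℂ →+* ℂ[X]) + HahnSeries.single (B.height.untopD 0) (X : ℂ[X])

open Classical in
/-- The exponent `q(B)`: the order of `f(λ_B(y) + z y ^ h(B), y)` if `B` has finite height,
and `⊤` otherwise. -/
def qExp (f : ConvSeries) (B : PseudoBall) : WithTop ℚ :=
  if B.height = ⊤ then ⊤ else (subst f B.generic).orderTop

/-- The polynomial `F_B`: the coefficient of `y ^ q(B)` in `f(λ_B(y) + z y ^ h(B), y)`
(used only for finite height). -/
def FPoly (f : ConvSeries) (B : PseudoBall) : ℂ[X] := (subst f B.generic).leadingCoeff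

/-- The critical values of a complex polynomial. -/
def criticalValues (F : ℂ[X]) : Set ℂ := {w | ∃ z : ℂ, F.derivative.eval z = 0 ∧ F.eval z = w}

/-! ### The Kuo-Lu tree-model and the Eggers tree -/

/-- The tree-model `T(f)`: the pseudo-balls `B(α, O(α, β))` with `α`, `β` Newton-Puiseux roots
of `f`, ordered by inclusion. -/
def treeModel (f : ConvSeries) : Set PseudoBall :=
  {B | ∃ α ∈ Zer f, ∃ β ∈ Zer f, B = ball α (contact α β) (contact_pos α β)}

/-- `B'` is a child of `B` in `T(f)`: it is strictly included in `B`, with nothing of `T(f)`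
strictly in between. -/
def IsChild (f : ConvSeries) (B B' : PseudoBall) : Prop :=
  B ∈ treeModel f ∧ B' ∈ treeModel f ∧ B'.carrier ⊂ B.carrier ∧
    ¬ ∃ A ∈ treeModel f, B'.carrier ⊂ A.carrier ∧ A.carrier ⊂ B.carrier

/-- The conjugacy relation: equal heights, and some irreducible `p` in `ℂ{x, y}` has a root in each
of the two pseudo-balls. -/
def Conj (B B' : PseudoBall) : Prop :=
  B.height = B'.height ∧
    ∃ p : ConvSeries, Irreducible p ∧ (∃ γ ∈ Zer p, γ ∈ B.carrier) ∧ ∃ γ ∈ Zer p, γ ∈ B'.carrier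

/-- The conjugacy class `[B]` in `T(f)`. -/
def conjClass (f : ConvSeries) (B : PseudoBall) : Set PseudoBall :=
  {B' | B' ∈ treeModel f ∧ Conj B B'}

/-- The set `E(f)` of all conjugacy classes, the vertices of the Eggers tree. -/
def eggersTree (f : ConvSeries) : Set (Set PseudoBall) := conjClass f '' treeModel f

/-- The parent-child relation induced on `E(f)` by that of `T(f)`. -/
def IsEggersChild (f : ConvSeries) (c c' : Set PseudoBall) : Prop :=
  c ∈ eggersTree f ∧ c' ∈ eggersTree f ∧ ∃ B ∈ c, ∃ B' ∈ c', IsChild f B B'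

/-- The number `t(c)` of children of a vertex `c` of the Eggers tree `E(f)`. -/
def numChildren (f : ConvSeries) (c : Set PseudoBall) : ℕ :=
  {c' : Set PseudoBall | IsEggersChild f c c'}.ncard

/-! ### The defining property of `q(B)` and `F_B` -/

theorem PseudoBall.coeff_eq {B : PseudoBall} {α γ : FracSeries} (hα : α ∈ B.carrier)
    (hγ : γ ∈ B.carrier) {e : ℚ} (he : (e : WithTop ℚ) < B.height) :
    γ.1.coeff e = α.1.coeff e := by
  obtain ⟨δ, hδ⟩ := B.exists_center
  rw [hδ] at hα hγ
  have h1 := HahnSeries.coeff_eq_zero_of_lt_orderTop (lt_of_lt_of_le he hα)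
  have h2 := HahnSeries.coeff_eq_zero_of_lt_orderTop (lt_of_lt_of_le he hγ)
  rw [HahnSeries.coeff_sub, sub_eq_zero] at h1 h2
  rw [h1, h2]

theorem PseudoBall.center_mem (B : PseudoBall) : B.center ∈ B.carrier := by
  have h := B.exists_center.choose_spec
  rw [h]
  simp [contact, PseudoBall.center]

section Leading

variable {K : Type*} [CommRing K]

/-- `u = c y ^ a + ⋯`, where `c = 0` is allowed. -/
def StartsWith (u : HahnSeries ℚ K) (a : ℚ) (c : K) : Prop :=
  (∀ e < a, u.coeff e = 0) ∧ u.coeff a = c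

theorem StartsWith.mul {u v : HahnSeries ℚ K} {a b : ℚ} {c d : K} (hu : StartsWith u a c)
    (hv : StartsWith v b d) : StartsWith (u * v) (a + b) (c * d) := by
  have key : ∀ i j : ℚ, u.coeff i ≠ 0 → v.coeff j ≠ 0 → a ≤ i ∧ b ≤ j := fun i j hi hj =>
    ⟨not_lt.1 fun h => hi (hu.1 _ h), not_lt.1 fun h => hj (hv.1 _ h)⟩
  refine ⟨fun e he => ?_, ?_⟩
  · rw [HahnSeries.coeff_mul]
    refine Finset.sum_eq_zero fun ij hij => ?_
    rw [Finset.mem_antidiagonal] at hij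
    have := key ij.1 ij.2 hij.1 hij.2.1
    linarith [hij.2.2]
  · rw [HahnSeries.coeff_mul, ← hu.2, ← hv.2]
    refine Finset.sum_eq_single (a, b) (fun ij hij hne => ?_) (fun hn => ?_)
    · rw [Finset.mem_antidiagonal] at hij
      have := key ij.1 ij.2 hij.1 hij.2.1
      refine absurd (Prod.ext ?_ ?_) hne <;> simp only <;> linarith [hij.2.2]
    · rw [Finset.mem_antidiagonal] at hn
      by_contra h
      exact hn ⟨left_ne_zero_of_mul h, right_ne_zero_of_mul h, rfl⟩

theorem StartsWith.one : StartsWith (1 : HahnSeries ℚ K) 0 1 :=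
  ⟨fun e he => by simp [HahnSeries.coeff_one, he.ne], by simp⟩

theorem StartsWith.pow {u : HahnSeries ℚ K} {a : ℚ} {c : K} (hu : StartsWith u a c) (n : ℕ) :
    StartsWith (u ^ n) (n * a) (c ^ n) := by
  induction n with
  | zero => simpa using StartsWith.one
  | succ n ih =>
    have := ih.mul hu
    rw [pow_succ, pow_succ, show ((n + 1 : ℕ) : ℚ) * a = n * a + a by push_cast; ring]
    exact this

theorem StartsWith.sum {ι : Type*} (s : Finset ι) {u : ι → HahnSeries ℚ K} {a : ℚ} {c : ι → K}
    (h : ∀ i ∈ s, StartsWith (u i) a (c i)) :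
    StartsWith (∑ i ∈ s, u i) a (∑ i ∈ s, c i) := by
  refine ⟨fun e he => ?_, ?_⟩
  · rw [HahnSeries.coeff_sum]
    exact Finset.sum_eq_zero fun i hi => (h i hi).1 e he
  · rw [HahnSeries.coeff_sum]
    exact Finset.sum_congr rfl fun i hi => (h i hi).2

theorem StartsWith.single (a : ℚ) (c : K) : StartsWith (HahnSeries.single a c) a c :=
  ⟨fun e he => HahnSeries.coeff_single_of_ne he.ne, by simp⟩

theorem StartsWith.ofLE {u : HahnSeries ℚ K} {a ε : ℚ} (h : ∀ e, u.coeff e ≠ 0 → ε ≤ e)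
    (ha : a < ε) : StartsWith u a 0 := by
  refine ⟨fun e he => ?_, ?_⟩ <;> by_contra hne <;> linarith [h _ hne]

variable [Algebra ℂ K]

theorem coeff_subst (f : ConvSeries) {φ : HahnSeries ℚ K} {ε : ℚ} (hε : 0 < ε)
    (hφ : ∀ e, φ.coeff e ≠ 0 → ε ≤ e) {e : ℚ} {N : ℕ} (hN1 : e < N) (hN2 : e < N * ε) :
    (subst f φ).coeff e = (∑ i ∈ Finset.range N, ∑ j ∈ Finset.range N,
      coeffXY f i j • (φ ^ i * HahnSeries.single (1 : ℚ) (1 : K) ^ j)).coeff e := by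
  have hpos : 0 < φ.orderTop := orderTop_pos fun e he => hε.trans_le (hφ e he)
  have hpos' : 0 < (HahnSeries.single (1 : ℚ) (1 : K)).orderTop := by
    refine orderTop_pos fun e he => ?_
    by_contra h
    exact he (HahnSeries.coeff_single_of_ne fun h' => h (by rw [h']; exact one_pos))
  have hst : StartsWith φ ε (φ.coeff ε) :=
    ⟨fun e he => by_contra fun h => absurd (hφ e h) (not_le.2 he), rfl⟩
  have hz : ∀ i j : ℕ, N ≤ i ∨ N ≤ j →
      (φ ^ i * HahnSeries.single (1 : ℚ) (1 : K) ^ j).coeff e = 0 := by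
    intro i j hij
    refine ((hst.pow i).mul ((StartsWith.single (1 : ℚ) (1 : K)).pow j)).1 e ?_
    have hi : (0 : ℚ) ≤ i * ε := by positivity
    have hj : (0 : ℚ) ≤ (j : ℚ) * 1 := by positivity
    rcases hij with h | h
    · have : (N : ℚ) * ε ≤ i * ε := by gcongr
      linarith
    · have : (N : ℚ) ≤ j := by exact_mod_cast h
      linarith
  rw [subst, HahnSeries.SummableFamily.hsum_smulFamily, ← Finset.sum_product',
    HahnSeries.coeff_sum, finsum_eq_sum_of_support_subset]
  · refine Finset.sum_congr rfl fun ij _ => ?_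
    simp [HahnSeries.SummableFamily.mul, hpos, hpos']
  · intro ij hij
    simp only [Finset.coe_product, Finset.coe_range, Set.mem_prod, Set.mem_Iio]
    by_contra hcon
    refine hij ?_
    have : N ≤ ij.1 ∨ N ≤ ij.2 := by
      by_contra h
      push Not at h
      exact hcon h
    have h0 := hz ij.1 ij.2 this
    simp only [HahnSeries.SummableFamily.mul, HahnSeries.SummableFamily.coe_mk,
      HahnSeries.SummableFamily.coe_powers hpos, HahnSeries.SummableFamily.coe_powers hpos', h0,
      smul_zero]

/-- Truncated Taylor coefficients of `f(x, y)` in `x` at `x = l(y)`. -/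
def taylorCoeff (f : ConvSeries) (l : HahnSeries ℚ K) (N k : ℕ) : HahnSeries ℚ K :=
  ∑ i ∈ Finset.range N, ∑ j ∈ Finset.range N,
    coeffXY f i j • ((i.choose k : HahnSeries ℚ K) * l ^ (i - k) *
      HahnSeries.single (1 : ℚ) (1 : K) ^ j)

theorem smul_mul_aux (c : ℂ) (u v : HahnSeries ℚ K) : c • u * v = c • (u * v) := by
  have h : ∀ w : HahnSeries ℚ K, c • w = HahnSeries.C (algebraMap ℂ K c) * w := by
    intro w
    ext e
    rw [HahnSeries.C_mul_eq_smul, HahnSeries.coeff_smul, HahnSeries.coeff_smul,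
      Algebra.smul_def, smul_eq_mul]
  rw [h, h, mul_assoc]

theorem taylor (f : ConvSeries) (l w : HahnSeries ℚ K) (N : ℕ) :
    (∑ i ∈ Finset.range N, ∑ j ∈ Finset.range N,
      coeffXY f i j • ((l + w) ^ i * HahnSeries.single (1 : ℚ) (1 : K) ^ j)) =
    ∑ k ∈ Finset.range N, taylorCoeff f l N k * w ^ k := by
  simp only [taylorCoeff, Finset.sum_mul]
  rw [Finset.sum_comm (s := Finset.range N) (t := Finset.range N)
    (f := fun k i => ∑ j ∈ Finset.range N, _)]
  refine Finset.sum_congr rfl fun i hi => ?_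
  rw [Finset.sum_comm]
  refine Finset.sum_congr rfl fun j _ => ?_
  have hb : (l + w) ^ i = ∑ k ∈ Finset.range N, w ^ k * l ^ (i - k) * (i.choose k) := by
    rw [add_comm, add_pow]
    refine Finset.sum_subset (Finset.range_mono (Finset.mem_range.1 hi)) fun k _ hk => ?_
    rw [Nat.choose_eq_zero_of_lt (by simpa using hk)]
    simp
  rw [hb, Finset.sum_mul, Finset.smul_sum]
  refine Finset.sum_congr rfl fun k _ => ?_
  rw [smul_mul_aux]
  congr 1
  ring

end Leading

/-- Extension of scalars from `ℂ` to `ℂ[z]`. -/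
def mapC : HahnSeries ℚ ℂ →+* HahnSeries ℚ ℂ[X] where
  toFun u := u.map (C : ℂ →+* ℂ[X])
  map_zero' := by ext; simp
  map_one' := by
    ext e : 2
    by_cases h : e = 0 <;> simp [HahnSeries.coeff_one, h]
  map_add' u v := by ext; simp
  map_mul' u v := HahnSeries.map_mul (C : ℂ →+* ℂ[X]).toNonUnitalRingHom

theorem coeff_mapC (u : HahnSeries ℚ ℂ) (e : ℚ) : (mapC u).coeff e = C (u.coeff e) := rfl

theorem mapC_taylorCoeff (f : ConvSeries) (l : HahnSeries ℚ ℂ) (N k : ℕ) :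
    mapC (taylorCoeff f l N k) = taylorCoeff f (mapC l) N k := by
  have hs : ∀ (c : ℂ) (u : HahnSeries ℚ ℂ), mapC (c • u) = c • mapC u := by
    intro c u
    ext e : 2
    simp [coeff_mapC, smul_eq_C_mul]
  have h1 : mapC (HahnSeries.single (1 : ℚ) (1 : ℂ)) = HahnSeries.single (1 : ℚ) (1 : ℂ[X]) := by
    ext e : 2
    by_cases h : e = 1 <;> simp [coeff_mapC, h]
  simp only [taylorCoeff, map_sum, hs, map_mul, map_pow, h1, map_natCast]

theorem FracSeries.exists_bound (φ : FracSeries) :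
    ∃ ε : ℚ, 0 < ε ∧ ∀ e, φ.1.coeff e ≠ 0 → ε ≤ e := by
  obtain ⟨N, hN, h, -⟩ := φ.2
  refine ⟨1 / N, by positivity, fun e he => ?_⟩
  obtain ⟨n, hn, rfl⟩ := h e he
  gcongr
  exact_mod_cast hn

theorem taylorCoeff_coeff_zero (f : ConvSeries) {l : HahnSeries ℚ ℂ} {ε : ℚ} (hε : 0 < ε)
    (hl : ∀ e, l.coeff e ≠ 0 → ε ≤ e) {N p : ℕ} (hp : p < N) :
    (taylorCoeff f l N p).coeff 0 = coeffXY f p 0 := by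
  have hN : 0 < N := by omega
  rw [taylorCoeff, HahnSeries.coeff_sum, Finset.sum_eq_single p, HahnSeries.coeff_sum,
    Finset.sum_eq_single 0]
  · simp
  · intro j _ hj
    simp only [HahnSeries.coeff_smul, Nat.choose_self, Nat.cast_one, Nat.sub_self, pow_zero,
      one_mul]
    rw [((StartsWith.single (1 : ℚ) (1 : ℂ)).pow j).1 0 (by positivity)]
    simp
  · intro h
    exact absurd (Finset.mem_range.2 hN) h
  · intro i _ hi
    rw [HahnSeries.coeff_sum]
    refine Finset.sum_eq_zero fun j _ => ?_
    rcases lt_or_gt_of_ne hi with h | h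
    · simp [Nat.choose_eq_zero_of_lt h]
    · have hl0 : StartsWith l ε (l.coeff ε) :=
        ⟨fun e he => by_contra fun h => absurd (hl e h) (not_le.2 he), rfl⟩
      have hik : 0 < i - p := by omega
      have := ((hl0.pow (i - p)).mul ((StartsWith.single (1 : ℚ) (1 : ℂ)).pow j)).1 0
        (by positivity)
      rw [HahnSeries.coeff_smul, mul_assoc, ← nsmul_eq_mul, HahnSeries.coeff_smul, this]
      simp
  · intro h
    exact absurd (Finset.mem_range.2 hp) h

/-- For every pseudo-ball `B` of finite height, `q(B)` is finite, `F_B` is a nonzero polynomial, and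
`f(γ(y), y) = F_B(z) y ^ q(B) + ⋯` for every `γ = λ_B + z y ^ h(B) + ⋯`. -/
theorem startsWith_subst (f : ConvSeries) (hf : (restrictX f).order < ⊤) (B : PseudoBall)
    (hB : B.height ≠ ⊤) :
    ∃ q : ℚ, qExp f B = q ∧ FPoly f B ≠ 0 ∧
      ∀ γ ∈ B.carrier, StartsWith (subst f γ.1) q ((FPoly f B).eval (B.lc γ)) := by
  obtain ⟨h, hh⟩ := WithTop.ne_top_iff_exists.1 hB
  have hu : B.height.untopD 0 = h := by rw [← hh]; rfl
  have hpos : 0 < h := by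
    have := B.height_pos
    rw [← hh] at this
    exact_mod_cast this
  obtain ⟨p, hp⟩ : ∃ p, coeffXY f p 0 ≠ 0 := by
    by_contra! hcon
    refine hf.ne (PowerSeries.order_eq_top.2 ?_)
    ext i
    simp [restrictX, hcon]
  obtain ⟨ε, hε, hc⟩ := B.center.exists_bound
  have hlam : ∀ e, B.lam.coeff e ≠ 0 → ε ≤ e := by
    intro e he
    refine hc e fun h0 => he ?_
    rw [PseudoBall.lam, HahnSeries.coeff_truncLT]
    simp [h0]
  have hlam' : ∀ e, h ≤ e → B.lam.coeff e = 0 := by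
    intro e he
    rw [PseudoBall.lam, hu]
    exact HahnSeries.coeff_truncLT_of_le he _
  have hgen : ∀ e, B.generic.coeff e ≠ 0 → min ε h ≤ e := by
    intro e he
    by_contra! hlt
    refine he ?_
    have h1 : B.lam.coeff e = 0 := by
      by_contra h2
      exact absurd (hlam e h2) (not_le.2 (hlt.trans_le (min_le_left _ _)))
    have h2 : e ≠ h := (hlt.trans_le (min_le_right _ _)).ne
    rw [PseudoBall.generic, hu, HahnSeries.coeff_add, HahnSeries.coeff_single_of_ne h2]
    simp [h1]
  have hm : 0 < min ε h := lt_min hε hpos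
  -- the coefficients of the generic substitution
  have hA : ∀ (e : ℚ) (N : ℕ), e < N → e < N * min ε h →
      (subst f B.generic).coeff e = ∑ k ∈ Finset.range N,
        C ((taylorCoeff f B.lam N k).coeff (e - k * h)) * X ^ k := by
    intro e N h1 h2
    rw [coeff_subst f hm hgen h1 h2]
    have : B.generic = mapC B.lam + HahnSeries.single h (X : ℂ[X]) := by
      rw [PseudoBall.generic, hu]; rfl
    rw [this, taylor, HahnSeries.coeff_sum]
    refine Finset.sum_congr rfl fun k _ => ?_
    rw [← mapC_taylorCoeff, HahnSeries.single_pow]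
    have he : e = (e - k * h) + k • h := by simp
    conv_lhs => rw [he]
    rw [HahnSeries.coeff_mul_single_add, coeff_mapC]
  have hcoeff : ∀ (e : ℚ) (N k : ℕ), e < N → e < N * min ε h → k < N →
      ((subst f B.generic).coeff e).coeff k = (taylorCoeff f B.lam N k).coeff (e - k * h) := by
    intro e N k h1 h2 hk
    rw [hA e N h1 h2, Polynomial.finsetSum_coeff, Finset.sum_eq_single k]
    · simp
    · intro j _ hj
      simp [Polynomial.coeff_X_pow, hj.symm]
    · intro h'
      exact absurd (Finset.mem_range.2 hk) h'
  have hbig : ∀ (a δ : ℚ), 0 < δ → ∃ N₀ : ℕ, ∀ N ≥ N₀, a < N * δ := by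
    intro a δ hδ
    obtain ⟨N₀, hN₀⟩ := exists_nat_gt (a / δ)
    refine ⟨N₀, fun N hN => ?_⟩
    rw [← div_lt_iff₀ hδ]
    exact hN₀.trans_le (by exact_mod_cast hN)
  have hne : subst f B.generic ≠ 0 := by
    intro h0
    obtain ⟨N₁, hN₁⟩ := hbig (p * h) 1 one_pos
    obtain ⟨N₂, hN₂⟩ := hbig (p * h) _ hm
    have h1 := hcoeff (p * h) (N₁ + N₂ + (p + 1)) p
      (by simpa using hN₁ (N₁ + N₂ + (p + 1)) (by omega)) (hN₂ _ (by omega)) (by omega)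
    rw [sub_self, taylorCoeff_coeff_zero f hε hlam (by omega), h0] at h1
    exact hp (by simpa using h1.symm)
  refine ⟨(subst f B.generic).order, ?_, HahnSeries.leadingCoeff_ne_zero.2 hne, ?_⟩
  · rw [qExp, if_neg hB, HahnSeries.order_eq_orderTop_of_ne_zero hne]
  intro γ hγ
  set q := (subst f B.generic).order with hq
  obtain ⟨δ, hδ, hγδ⟩ := γ.exists_bound
  obtain ⟨N₁, hN₁⟩ := hbig q 1 one_pos
  obtain ⟨N₂, hN₂⟩ := hbig q _ hm
  obtain ⟨N₃, hN₃⟩ := hbig q _ hδ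
  obtain ⟨N, hN⟩ : ∃ N, N = N₁ + N₂ + N₃ := ⟨_, rfl⟩
  have hq1 : q < N := by simpa using hN₁ N (by omega)
  have hq2 : q < N * min ε h := hN₂ N (by omega)
  have hq3 : q < N * δ := hN₃ N (by omega)
  have hw : StartsWith (γ.1 - B.lam) h (B.lc γ) := by
    refine ⟨fun e he => ?_, ?_⟩
    · have he' : (e : WithTop ℚ) < B.height := by
        rw [← hh]
        exact_mod_cast he
      rw [HahnSeries.coeff_sub, PseudoBall.coeff_eq B.center_mem hγ he', PseudoBall.lam, hu,
        HahnSeries.coeff_truncLT_of_lt he, sub_self]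
    · rw [HahnSeries.coeff_sub, hlam' h le_rfl, sub_zero, PseudoBall.lc, hu]
  have hT : ∀ k ∈ Finset.range N, StartsWith (taylorCoeff f B.lam N k) (q - k * h)
      ((FPoly f B).coeff k) := by
    intro k hk
    have hk := Finset.mem_range.1 hk
    refine ⟨fun e he => ?_, ?_⟩
    · have hlt : e + k * h < q := by linarith
      have h1 := hcoeff (e + k * h) N k (hlt.trans hq1) (hlt.trans hq2) hk
      rw [HahnSeries.coeff_eq_zero_of_lt_order hlt] at h1
      simpa using h1.symm
    · rw [FPoly, HahnSeries.leadingCoeff_eq, ← hcoeff q N k hq1 hq2 hk]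
  have hsum := StartsWith.sum (Finset.range N)
    (fun k hk => by
      have := (hT k hk).mul (hw.pow k)
      rwa [sub_add_cancel] at this)
  have heq : ∀ e ≤ q, (subst f γ.1).coeff e =
      (∑ k ∈ Finset.range N, taylorCoeff f B.lam N k * (γ.1 - B.lam) ^ k).coeff e := by
    intro e he
    rw [coeff_subst f hδ hγδ (he.trans_lt hq1) (he.trans_lt hq3), ← taylor, add_sub_cancel]
  have hev : (FPoly f B).eval (B.lc γ) =
      ∑ k ∈ Finset.range N, (FPoly f B).coeff k * B.lc γ ^ k := by
    refine Polynomial.eval_eq_sum_range' ?_ _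
    by_contra! hcon
    have hN0 : N ≤ (FPoly f B).natDegree := hcon
    have hz : (FPoly f B).coeff (FPoly f B).natDegree = 0 := by
      rw [FPoly, HahnSeries.leadingCoeff_eq, hA _ N hq1 hq2, Polynomial.finsetSum_coeff]
      refine Finset.sum_eq_zero fun k hk => ?_
      have hk := Finset.mem_range.1 hk
      rw [FPoly, HahnSeries.leadingCoeff_eq, hA _ N hq1 hq2] at hN0
      rw [Polynomial.coeff_C_mul_X_pow, if_neg (by omega)]
    have : FPoly f B ≠ 0 := HahnSeries.leadingCoeff_ne_zero.2 hne
    exact this (Polynomial.leadingCoeff_eq_zero.1 hz)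
  rw [hev]
  exact ⟨fun e he => (heq e he.le).trans (hsum.1 e he), (heq q le_rfl).trans hsum.2⟩

end KuoLu

end

noncomputable section

namespace KuoLu

open Polynomial
open scoped ENNReal NNReal

/-! ### Weighted norms of power series in two variables -/

/-! The argument exploits the symmetry `y ^ e ↦ exp (2πi k e) y ^ e` of fractional power series
(`conjHom k`), which commutes with substitution into `f`. Let `h = h(B)`. The integers `k` whose
symmetry fixes `λ_B` form a subgroup of `ℤ`, say generated by `N`. They act on the leading
coefficients of members of `B` through the powers of `ω = exp (2πi N h)`, a root of unity of some
order `n`. Comparing the initial terms of `f(γ(y), y)` for `γ` and its conjugate gives `F_B(ω z) =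
F_B(z)`, because `q(B)` is an integer (`FPoly_eval_mul`). Hence `F_B(z) = G(z ^ n)` for some
polynomial `G` (`exists_eq_expand`).

By the chain rule, a critical value of `F_B` is either `G(0)` or a critical value of `G`. Counting
zeros of `G'` with multiplicity shows that `G` has fewer nonzero critical values than distinct roots
(`encard_criticalValues_add_one_le`). The extra value `G(0)` uses up the difference, so `F_B` has at
most as many nonzero critical values as `G` has distinct roots.

The distinct roots of `G` inject into the children of `[B]`. If `G(s) = 0` and `z ^ n = s`, then `z`
is the leading coefficient of a Newton-Puiseux root of `f` in `B` (`exists_mem_Zer_lc_eq`), and that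
root lies in a child of `B` (`exists_child`). If two such children are conjugate, some symmetry
takes a member of one to a member of the other (`exists_conj_eq`). It fixes `λ_B`, so it multiplies
leading coefficients by an `n`-th root of unity and leaves `s` unchanged.

The two analytic inputs are the lifting of roots of `F_B` and the conjugacy of the roots of an
irreducible series. Both rest on Weierstrass division in `ℂ{x, y}`; the first also uses a convergent
Newton-Puiseux theorem. -/

/-- The weighted `ℓ¹` norm of a power series in two variables, with weights `r` and `s`. -/
def wnorm (r s : ℝ≥0∞) (u : MvPowerSeries (Fin 2) ℂ) : ℝ≥0∞ :=
  ∑' k : Fin 2 →₀ ℕ, ‖MvPowerSeries.coeff k u‖ₑ * (r ^ k 0 * s ^ k 1)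

theorem wnorm_add_le (r s : ℝ≥0∞) (u v : MvPowerSeries (Fin 2) ℂ) :
    wnorm r s (u + v) ≤ wnorm r s u + wnorm r s v := by
  rw [wnorm, wnorm, wnorm, ← ENNReal.tsum_add]
  refine ENNReal.tsum_le_tsum fun k => ?_
  rw [← add_mul, map_add]
  gcongr
  exact enorm_add_le _ _

theorem wnorm_mul_le (r s : ℝ≥0∞) (u v : MvPowerSeries (Fin 2) ℂ) :
    wnorm r s (u * v) ≤ wnorm r s u * wnorm r s v := by
  classical
  have h1 : wnorm r s u * wnorm r s v = ∑' p : (Fin 2 →₀ ℕ) × (Fin 2 →₀ ℕ),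
      (‖MvPowerSeries.coeff p.1 u‖ₑ * (r ^ p.1 0 * s ^ p.1 1)) *
        (‖MvPowerSeries.coeff p.2 v‖ₑ * (r ^ p.2 0 * s ^ p.2 1)) := by
    rw [wnorm, wnorm, ENNReal.tsum_prod', ← ENNReal.tsum_mul_right]
    refine tsum_congr fun a => ?_
    rw [← ENNReal.tsum_mul_left]
  rw [h1, ← (Finset.HasAntidiagonal.sigmaAntidiagonalEquivProd (A := Fin 2 →₀ ℕ)).tsum_eq, ENNReal.tsum_sigma',
    wnorm]
  refine ENNReal.tsum_le_tsum fun k => ?_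
  simp only [Finset.HasAntidiagonal.sigmaAntidiagonalEquivProd_apply]
  rw [MvPowerSeries.coeff_mul, tsum_fintype,
    Finset.sum_coe_sort (Finset.HasAntidiagonal.antidiagonal k) fun x : (Fin 2 →₀ ℕ) × (Fin 2 →₀ ℕ) =>
      (‖MvPowerSeries.coeff x.1 u‖ₑ * (r ^ x.1 0 * s ^ x.1 1)) *
        (‖MvPowerSeries.coeff x.2 v‖ₑ * (r ^ x.2 0 * s ^ x.2 1))]
  refine (mul_le_mul_left (enorm_sum_le _ _) _).trans ?_
  rw [Finset.sum_mul]
  refine Finset.sum_le_sum fun x hx => le_of_eq ?_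
  rw [← Finset.HasAntidiagonal.mem_antidiagonal.1 hx, enorm_mul, Finsupp.add_apply, Finsupp.add_apply, pow_add,
    pow_add]
  ring

theorem wnorm_mono {r s r' s' : ℝ≥0∞} (hr : r ≤ r') (hs : s ≤ s') (u : MvPowerSeries (Fin 2) ℂ) :
    wnorm r s u ≤ wnorm r' s' u :=
  ENNReal.tsum_le_tsum fun _ => by gcongr

theorem degree_fin_two (k : Fin 2 →₀ ℕ) : k.degree = k 0 + k 1 := by
  rw [Finsupp.degree_eq_sum, Fin.sum_univ_two]

theorem wnorm_ne_top_iff (r : ℝ≥0) (u : MvPowerSeries (Fin 2) ℂ) :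
    wnorm r r u ≠ ⊤ ↔
      Summable fun m : Fin 2 →₀ ℕ => ‖MvPowerSeries.coeff m u‖ * (r : ℝ) ^ m.degree := by
  have h1 : wnorm r r u =
      ∑' m : Fin 2 →₀ ℕ, ((‖MvPowerSeries.coeff m u‖₊ * r ^ m.degree : ℝ≥0) : ℝ≥0∞) := by
    refine tsum_congr fun k => ?_
    rw [degree_fin_two, ENNReal.coe_mul, ENNReal.coe_pow, pow_add]
    rfl
  rw [h1, ENNReal.tsum_coe_ne_top_iff_summable, ← NNReal.summable_coe]
  simp

/-- With values in `ℝ≥0∞`, convergence becomes finiteness of a norm, and the estimates for division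
need no summability side conditions. -/
theorem isConvergent_iff {u : MvPowerSeries (Fin 2) ℂ} :
    IsConvergent u ↔ ∃ r : ℝ≥0, 0 < r ∧ wnorm r r u ≠ ⊤ := by
  constructor
  · rintro ⟨r, hr, h⟩
    exact ⟨⟨r, hr.le⟩, hr, (wnorm_ne_top_iff _ _).2 h⟩
  · rintro ⟨r, hr, h⟩
    exact ⟨r, hr, (wnorm_ne_top_iff _ _).1 h⟩

theorem isConvergent_of_wnorm_ne_top {u : MvPowerSeries (Fin 2) ℂ} {r s : ℝ≥0} (hr : 0 < r)
    (hs : 0 < s) (h : wnorm r s u ≠ ⊤) : IsConvergent u :=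
  isConvergent_iff.2 ⟨min r s, lt_min hr hs, ne_top_of_le_ne_top h
    (wnorm_mono (by simp) (by simp) u)⟩

/-- The weighted degree for which `x` has weight `1` and `y` has weight `m + 1`. -/
def wdeg (m : ℕ) (k : Fin 2 →₀ ℕ) : ℕ := k 0 + (m + 1) * k 1

theorem wdeg_add (m : ℕ) (k l : Fin 2 →₀ ℕ) : wdeg m (k + l) = wdeg m k + wdeg m l := by
  simp only [wdeg, Finsupp.add_apply]
  ring

/-- With radii `ρ x` and `ρ x ^ (m + 1)`, a monomial of weight `w` shrinks by `x ^ w`. So `a`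
shrinks by `x ^ (m + 1)`, one power faster than the `m`-th power of the first radius; this makes the
division step a contraction for small `x`. -/
theorem wnorm_scale_le {a : MvPowerSeries (Fin 2) ℂ} {m : ℕ}
    (ha : ∀ k, MvPowerSeries.coeff k a ≠ 0 → m + 1 ≤ wdeg m k) (ρ x : ℝ≥0) (hx : x ≤ 1) :
    wnorm (ρ * x : ℝ≥0) (ρ * x ^ (m + 1) : ℝ≥0) a ≤ x ^ (m + 1) * wnorm ρ ρ a := by
  rw [wnorm, wnorm, ← ENNReal.tsum_mul_left]
  refine ENNReal.tsum_le_tsum fun k => ?_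
  by_cases hk : MvPowerSeries.coeff k a = 0
  · simp [hk]
  have h1 : x ^ wdeg m k ≤ x ^ (m + 1) := pow_le_pow_of_le_one (by positivity) hx (ha k hk)
  have h2 : ((ρ * x) ^ k 0 * (ρ * x ^ (m + 1)) ^ k 1 : ℝ≥0) ≤
      x ^ (m + 1) * (ρ ^ k 0 * ρ ^ k 1) := by
    calc ((ρ * x) ^ k 0 * (ρ * x ^ (m + 1)) ^ k 1 : ℝ≥0)
        = x ^ wdeg m k * (ρ ^ k 0 * ρ ^ k 1) := by
          rw [wdeg, pow_add x (k 0), pow_mul]; ring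
      _ ≤ _ := by gcongr
  have h3 : ((((ρ * x) ^ k 0 * (ρ * x ^ (m + 1)) ^ k 1 : ℝ≥0)) : ℝ≥0∞) ≤
      ((x ^ (m + 1) * (ρ ^ k 0 * ρ ^ k 1) : ℝ≥0) : ℝ≥0∞) := by exact_mod_cast h2
  calc _ ≤ ‖MvPowerSeries.coeff k a‖ₑ * ((x ^ (m + 1) * (ρ ^ k 0 * ρ ^ k 1) : ℝ≥0) : ℝ≥0∞) := by
        refine mul_le_mul_right ?_ _
        push_cast at h3 ⊢
        exact h3
    _ = _ := by push_cast; ring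

/-! ### Weierstrass division -/

section Division

variable (m : ℕ) (f a : MvPowerSeries (Fin 2) ℂ)

/-- The operator whose fixed points are the quotients of `f` by `x ^ m - a`. -/
def divStep (q : MvPowerSeries (Fin 2) ℂ) : MvPowerSeries (Fin 2) ℂ :=
  fun k => MvPowerSeries.coeff (k + Finsupp.single 0 m) (f + q * a)

theorem coeff_divStep (q : MvPowerSeries (Fin 2) ℂ) (k : Fin 2 →₀ ℕ) :
    MvPowerSeries.coeff k (divStep m f a q) =
      MvPowerSeries.coeff (k + Finsupp.single 0 m) (f + q * a) := rfl

/-- The step discards the monomials not divisible by `x ^ m` and divides the others by `x ^ m`. This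
is injective on the monomials kept and divides their weights by `r ^ m`. -/
theorem wnorm_divStep_le (r s : ℝ≥0∞) (q : MvPowerSeries (Fin 2) ℂ) :
    r ^ m * wnorm r s (divStep m f a q) ≤ wnorm r s f + wnorm r s q * wnorm r s a := by
  refine le_trans ?_ ((wnorm_add_le r s f (q * a)).trans
    (add_le_add le_rfl (wnorm_mul_le r s q a)))
  rw [wnorm, wnorm, ← ENNReal.tsum_mul_left]
  refine le_trans (le_of_eq (tsum_congr fun k => ?_))
    (ENNReal.tsum_comp_le_tsum_of_injective (f := fun k : Fin 2 →₀ ℕ => k + Finsupp.single 0 m)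
      (add_left_injective _) _)
  rw [coeff_divStep]
  simp [pow_add]
  ring

variable {m a}

/-- Multiplication by `a` raises weighted degrees by at least `m + 1` and division by `x ^ m` lowers
them by `m`, so each step fixes one more degree. -/
theorem coeff_divStep_congr (ha : ∀ k, MvPowerSeries.coeff k a ≠ 0 → m + 1 ≤ wdeg m k)
    {n : ℕ} {u v : MvPowerSeries (Fin 2) ℂ}
    (h : ∀ k, wdeg m k < n → MvPowerSeries.coeff k u = MvPowerSeries.coeff k v)
    (k : Fin 2 →₀ ℕ) (hk : wdeg m k < n + 1) :
    MvPowerSeries.coeff k (divStep m f a u) = MvPowerSeries.coeff k (divStep m f a v) := by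
  classical
  rw [coeff_divStep, coeff_divStep, map_add, map_add, MvPowerSeries.coeff_mul,
    MvPowerSeries.coeff_mul]
  congr 1
  refine Finset.sum_congr rfl fun x hx => ?_
  by_cases hx2 : MvPowerSeries.coeff x.2 a = 0
  · simp [hx2]
  rw [h]
  have h1 := congrArg (wdeg m) (Finset.HasAntidiagonal.mem_antidiagonal.1 hx)
  have h2 : wdeg m (Finsupp.single 0 m) = m := by simp [wdeg]
  rw [wdeg_add, wdeg_add, h2] at h1
  have := ha _ hx2
  omega

/-- The quotient in the Weierstrass division of `f` by `x ^ m - a`. -/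
def divQuot (m : ℕ) (f a : MvPowerSeries (Fin 2) ℂ) : MvPowerSeries (Fin 2) ℂ :=
  fun k => MvPowerSeries.coeff k ((divStep m f a)^[wdeg m k + 1] 0)

theorem coeff_iterate_divStep (ha : ∀ k, MvPowerSeries.coeff k a ≠ 0 → m + 1 ≤ wdeg m k)
    (n : ℕ) (k : Fin 2 →₀ ℕ) (hk : wdeg m k < n) :
    MvPowerSeries.coeff k ((divStep m f a)^[n] 0) = MvPowerSeries.coeff k (divQuot m f a) := by
  have h1 : ∀ (n : ℕ) (k : Fin 2 →₀ ℕ), wdeg m k < n →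
      MvPowerSeries.coeff k ((divStep m f a)^[n] 0) =
        MvPowerSeries.coeff k ((divStep m f a)^[n + 1] 0) := by
    intro n
    induction n with
    | zero => simp
    | succ n ih =>
      intro k hk
      rw [Function.iterate_succ_apply', Function.iterate_succ_apply' _ (n + 1)]
      exact coeff_divStep_congr f ha ih k hk
  induction n, Nat.succ_le_of_lt hk using Nat.le_induction with
  | base => rfl
  | succ n hn ih => rw [← h1 n k hn, ih hn]

theorem divStep_divQuot (ha : ∀ k, MvPowerSeries.coeff k a ≠ 0 → m + 1 ≤ wdeg m k) :
    divStep m f a (divQuot m f a) = divQuot m f a := by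
  ext k
  rw [← coeff_iterate_divStep f ha (wdeg m k + 1) k (by omega), Function.iterate_succ_apply']
  exact coeff_divStep_congr f ha
    (fun l hl => (coeff_iterate_divStep f ha _ l hl).symm) k (by omega)

/-- The bound `2‖f‖` is preserved by each step, since `‖f‖ + 2‖f‖ / 2 = 2‖f‖`. It passes to the
limit because every finite partial sum of the norm already occurs in an iterate. -/
theorem wnorm_divQuot_le (ha : ∀ k, MvPowerSeries.coeff k a ≠ 0 → m + 1 ≤ wdeg m k)
    {r s : ℝ≥0∞} (hsmall : wnorm r s a ≤ r ^ m / 2) :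
    r ^ m * wnorm r s (divQuot m f a) ≤ wnorm r s f + wnorm r s f := by
  have hn : ∀ n, r ^ m * wnorm r s ((divStep m f a)^[n] 0) ≤ wnorm r s f + wnorm r s f := by
    intro n
    induction n with
    | zero => simp [wnorm]
    | succ n ih =>
      rw [Function.iterate_succ_apply']
      refine (wnorm_divStep_le m f a r s _).trans (add_le_add le_rfl ?_)
      calc _ ≤ wnorm r s ((divStep m f a)^[n] 0) * (r ^ m / 2) := by gcongr
        _ = (r ^ m * wnorm r s ((divStep m f a)^[n] 0)) / 2 := by
          simp only [div_eq_mul_inv]; ring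
        _ ≤ (wnorm r s f + wnorm r s f) / 2 := by gcongr
        _ = _ := by rw [← two_mul, mul_comm, ENNReal.mul_div_cancel_right two_ne_zero (by simp)]
  rw [wnorm, ← ENNReal.tsum_mul_left, ENNReal.tsum_eq_iSup_sum]
  refine iSup_le fun S => ?_
  refine le_trans (le_trans (Finset.sum_le_sum fun k hk => ?_) (ENNReal.sum_le_tsum S))
    ((ENNReal.tsum_mul_left).trans_le (hn (S.sup (wdeg m) + 1)))
  rw [coeff_iterate_divStep f ha _ k (Nat.lt_succ_of_le (Finset.le_sup hk))]

theorem isConvergent_divQuot (hf : IsConvergent f) (hac : IsConvergent a)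
    (ha : ∀ k, MvPowerSeries.coeff k a ≠ 0 → m + 1 ≤ wdeg m k) :
    IsConvergent (divQuot m f a) := by
  obtain ⟨ρ₁, hρ₁, h1⟩ := isConvergent_iff.1 hf
  obtain ⟨ρ₂, hρ₂, h2⟩ := isConvergent_iff.1 hac
  obtain ⟨ρ, hρ⟩ : ∃ ρ, ρ = min ρ₁ ρ₂ := ⟨_, rfl⟩
  have hρ0 : 0 < ρ := hρ ▸ lt_min hρ₁ hρ₂
  have hρ1 : (ρ : ℝ≥0∞) ≤ ρ₁ := by rw [hρ]; simp
  have hρ2 : (ρ : ℝ≥0∞) ≤ ρ₂ := by rw [hρ]; simp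
  have hf' : wnorm ρ ρ f ≠ ⊤ := ne_top_of_le_ne_top h1 (wnorm_mono hρ1 hρ1 f)
  lift wnorm ρ ρ a to ℝ≥0 using ne_top_of_le_ne_top h2 (wnorm_mono hρ2 hρ2 a) with A hA
  -- Chosen so that `x * A ≤ ρ ^ m / 2`, which is the smallness condition after rescaling; `A + 1`
  -- avoids a zero denominator.
  obtain ⟨x, hx⟩ : ∃ x : ℝ≥0, x = min 1 (ρ ^ m / (2 * (A + 1))) := ⟨_, rfl⟩
  have hx0 : 0 < x := by rw [hx]; positivity
  have hx1 : x ≤ 1 := hx ▸ min_le_left _ _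
  have hx2 : x * A ≤ ρ ^ m / 2 := by
    calc x * A ≤ ρ ^ m / (2 * (A + 1)) * (A + 1) := by
          gcongr
          · exact hx ▸ min_le_right _ _
          · simp
      _ = ρ ^ m / 2 := by field_simp
  have hsmall : wnorm (ρ * x : ℝ≥0) (ρ * x ^ (m + 1) : ℝ≥0) a ≤ ((ρ * x : ℝ≥0) : ℝ≥0∞) ^ m / 2 := by
    refine (wnorm_scale_le ha ρ x hx1).trans ?_
    have h3 : x ^ (m + 1) * A ≤ (ρ * x) ^ m / 2 := by
      calc x ^ (m + 1) * A = x ^ m * (x * A) := by ring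
        _ ≤ x ^ m * (ρ ^ m / 2) := by gcongr
        _ = _ := by rw [mul_pow]; ring
    rw [← hA]
    have h4 : ((x ^ (m + 1) * A : ℝ≥0) : ℝ≥0∞) ≤ (((ρ * x) ^ m / 2 : ℝ≥0) : ℝ≥0∞) := by
      exact_mod_cast h3
    rw [ENNReal.coe_div two_ne_zero] at h4
    push_cast at h4 ⊢
    exact h4
  have hy1 : ρ * x ≤ ρ := mul_le_of_le_one_right' hx1
  have hy2 : ρ * x ^ (m + 1) ≤ ρ := mul_le_of_le_one_right' (pow_le_one₀ (by positivity) hx1)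
  have hf2 : wnorm (ρ * x : ℝ≥0) (ρ * x ^ (m + 1) : ℝ≥0) f ≠ ⊤ :=
    ne_top_of_le_ne_top hf' (wnorm_mono (by exact_mod_cast hy1) (by exact_mod_cast hy2) f)
  have hpos : 0 < ρ * x := by positivity
  refine isConvergent_of_wnorm_ne_top hpos (s := ρ * x ^ (m + 1)) (by positivity) fun htop => ?_
  have h5 := wnorm_divQuot_le f ha hsmall
  rw [htop, ENNReal.mul_top (by positivity), top_le_iff] at h5
  exact ENNReal.add_ne_top.2 ⟨hf2, hf2⟩ h5

end Division

/-! ### Coordinates on `ℂ{x, y}` and division by an `x`-regular series -/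

theorem coeff_eq_coeffXY (f : ConvSeries) (k : Fin 2 →₀ ℕ) :
    MvPowerSeries.coeff k f.1 = coeffXY f (k 0) (k 1) := by
  rw [coeffXY]
  congr 2
  ext i
  fin_cases i <;> simp

theorem ConvSeries.ext {f g : ConvSeries} (h : ∀ i j, coeffXY f i j = coeffXY g i j) : f = g := by
  refine Subtype.ext (MvPowerSeries.ext fun k => ?_)
  rw [coeff_eq_coeffXY, coeff_eq_coeffXY, h]

theorem coeffXY_add (f g : ConvSeries) (i j : ℕ) :
    coeffXY (f + g) i j = coeffXY f i j + coeffXY g i j := map_add _ _ _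

/-- Weierstrass division of convergent power series. -/
theorem weierstrass_division (f g : ConvSeries) {m : ℕ} (hlt : ∀ i < m, coeffXY g i 0 = 0)
    (hm : coeffXY g m 0 ≠ 0) :
    ∃ q r : ConvSeries, f = q * g + r ∧ ∀ i j, m ≤ i → coeffXY r i j = 0 := by
  classical
  set c := coeffXY g m 0 with hc
  set b : MvPowerSeries (Fin 2) ℂ := MvPowerSeries.monomial 0 c⁻¹ with hb
  set xm : MvPowerSeries (Fin 2) ℂ := MvPowerSeries.monomial (Finsupp.single 0 m) 1 with hxm
  -- Up to the constant `c`, the divisor `g` is `x ^ m - a`, and regularity says that all monomials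
  -- of `a` have weight at least `m + 1`. For the fixed point `q` of the division step, `f + q a - q
  -- x ^ m` has no monomial divisible by `x ^ m`: it is the remainder.
  set a : MvPowerSeries (Fin 2) ℂ := xm - b * g.1 with ha
  have hbc : IsConvergent b := isConvergent_monomial _ _
  have hac : IsConvergent a := by
    rw [ha, sub_eq_add_neg]
    exact (isConvergent_monomial _ _).add (hbc.mul g.2).neg
  have hcoef : ∀ k, MvPowerSeries.coeff k a =
      (if k = Finsupp.single 0 m then 1 else 0) - c⁻¹ * coeffXY g (k 0) (k 1) := by
    intro k
    rw [ha, map_sub, hxm, MvPowerSeries.coeff_monomial, hb, MvPowerSeries.monomial_zero_eq_C_apply,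
      MvPowerSeries.coeff_C_mul, coeff_eq_coeffXY]
  have hw : ∀ k, MvPowerSeries.coeff k a ≠ 0 → m + 1 ≤ wdeg m k := by
    intro k hk
    by_contra! hlt'
    refine hk ?_
    have hk1 : k 1 = 0 := by
      by_contra h
      have : (m + 1) * 1 ≤ (m + 1) * k 1 := Nat.mul_le_mul_left _ (Nat.pos_of_ne_zero h)
      rw [wdeg] at hlt'
      omega
    rw [hcoef, hk1]
    rw [wdeg, hk1] at hlt'
    rcases Nat.lt_or_ge (k 0) m with h | h
    · rw [hlt _ h, if_neg]
      · simp
      · rintro rfl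
        simp at h
    · have hk0 : k 0 = m := by omega
      have : k = Finsupp.single 0 m := by
        ext i
        fin_cases i <;> simp [hk0, hk1]
      rw [if_pos this, hk0, ← hc, inv_mul_cancel₀ hm, sub_self]
  have hq := isConvergent_divQuot f.1 f.2 hac hw
  have hfix := divStep_divQuot f.1 hw
  refine ⟨⟨divQuot m f.1 a * b, hq.mul hbc⟩, f - ⟨divQuot m f.1 a * b, hq.mul hbc⟩ * g, by ring, ?_⟩
  intro i j hi
  have hr : (f - ⟨divQuot m f.1 a * b, hq.mul hbc⟩ * g : ConvSeries).1 =
      f.1 + divQuot m f.1 a * a - divQuot m f.1 a * xm := by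
    change f.1 - divQuot m f.1 a * b * g.1 = _
    rw [ha]
    ring
  obtain ⟨i', rfl⟩ := Nat.exists_eq_add_of_le' hi
  rw [coeffXY, hr, map_sub, hxm]
  have hk : (Finsupp.single 0 (i' + m) + Finsupp.single 1 j : Fin 2 →₀ ℕ) =
      (Finsupp.single 0 i' + Finsupp.single 1 j) + Finsupp.single 0 m := by
    rw [Finsupp.single_add]
    abel
  rw [hk, MvPowerSeries.coeff_add_mul_monomial, mul_one, ← coeff_divStep, hfix, sub_self]

/-! ### Convergent power series in one variable -/

theorem coeff_toMvPowerSeries (a : PowerSeries ℂ) (k : Fin 2 →₀ ℕ) :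
    MvPowerSeries.coeff k (PowerSeries.toMvPowerSeries (1 : Fin 2) a) =
      if k 0 = 0 then PowerSeries.coeff (k 1) a else 0 := by
  classical
  rw [PowerSeries.toMvPowerSeries_apply]
  split_ifs with h
  · have hk : k = Finsupp.embDomain (Function.Embedding.punit (1 : Fin 2))
        (Finsupp.single () (k 1)) := by
      rw [Finsupp.embDomain_single]
      ext i
      fin_cases i
      · exact h.trans (Finsupp.single_eq_of_ne zero_ne_one).symm
      · exact (Finsupp.single_eq_same).symm
    conv_lhs => rw [hk]
    exact MvPowerSeries.coeff_embDomain_rename (Function.Embedding.punit (1 : Fin 2)) _ _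
  · refine MvPowerSeries.coeff_rename_eq_zero _ _ ?_
    rintro ⟨l, rfl⟩
    refine h ?_
    rw [Finsupp.mapDomain_of_notMem_range]
    rintro ⟨_, hi⟩
    exact absurd hi one_ne_zero

/-- The ring `ℂ{y}`. -/
def convSubring₁ : Subring (PowerSeries ℂ) :=
  convergentSubring.comap (PowerSeries.toMvPowerSeries (R := ℂ) (1 : Fin 2)).toRingHom

/-- The type `ℂ{y}`. -/
abbrev ConvSeries₁ : Type := convSubring₁

theorem mem_convSubring₁ {a : PowerSeries ℂ} :
    a ∈ convSubring₁ ↔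
      ∃ r : ℝ, 0 < r ∧ Summable fun n => ‖PowerSeries.coeff n a‖ * r ^ n := by
  change (∃ r : ℝ, 0 < r ∧ Summable fun m : Fin 2 →₀ ℕ =>
    ‖MvPowerSeries.coeff m (PowerSeries.toMvPowerSeries (1 : Fin 2) a)‖ * r ^ m.degree) ↔ _
  refine exists_congr fun r => and_congr_right fun _ => ?_
  rw [← (Finsupp.single_injective (1 : Fin 2)).summable_iff]
  · refine summable_congr fun n => ?_
    simp [coeff_toMvPowerSeries]
  · intro k hk
    rw [coeff_toMvPowerSeries, if_neg, norm_zero, zero_mul]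
    intro h
    refine hk ⟨k 1, ?_⟩
    ext i
    fin_cases i <;> simp [h]

/-- The inclusion of `ℂ{y}` into `ℂ{x, y}`. -/
def inclY : ConvSeries₁ →+* ConvSeries :=
  ((PowerSeries.toMvPowerSeries (R := ℂ) (1 : Fin 2)).toRingHom.comp
    convSubring₁.subtype).codRestrict convergentSubring fun a => a.2

theorem coeffXY_inclY (a : ConvSeries₁) (i j : ℕ) :
    coeffXY (inclY a) i j = if i = 0 then PowerSeries.coeff j a.1 else 0 := by
  refine (coeff_toMvPowerSeries a.1 _).trans ?_
  simp

/-- The inclusion of `ℂ{y}` into the field of Hahn series. -/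
def inclHahn : ConvSeries₁ →+* HahnSeries ℚ ℂ :=
  (HahnSeries.ofPowerSeries ℚ ℂ).comp convSubring₁.subtype

theorem inclHahn_injective : Function.Injective inclHahn :=
  HahnSeries.ofPowerSeries_injective.comp Subtype.val_injective

theorem ofPowerSeries_coeff (a : PowerSeries ℂ) (e : ℚ) (he : ∀ n : ℕ, e ≠ n) :
    (HahnSeries.ofPowerSeries ℚ ℂ a).coeff e = 0 := by
  rw [HahnSeries.ofPowerSeries_apply]
  refine HahnSeries.embDomain_of_notMem_range ?_
  rintro ⟨n, hn⟩
  exact he n hn.symm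

/-! ### Change of the exponents and conjugation -/

/-- The automorphism `y ↦ y ^ c` of the field of Hahn series. -/
def powMap (c : ℚ) (hc : 0 < c) : HahnSeries ℚ ℂ →+* HahnSeries ℚ ℂ :=
  HahnSeries.embDomainRingHom (AddMonoidHom.mulLeft c) (mul_right_injective₀ hc.ne')
    fun _ _ => mul_le_mul_iff_right₀ hc

theorem coeff_powMap {c : ℚ} (hc : 0 < c) (u : HahnSeries ℚ ℂ) (e : ℚ) :
    (powMap c hc u).coeff e = u.coeff (e / c) := by
  have h : e = c * (e / c) := by field_simp
  conv_lhs => rw [h]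
  exact HahnSeries.embDomain_coeff (f := ⟨⟨AddMonoidHom.mulLeft c, mul_right_injective₀ hc.ne'⟩,
    mul_le_mul_iff_right₀ hc⟩)

theorem powMap_single {c : ℚ} (hc : 0 < c) (e : ℚ) (z : ℂ) :
    powMap c hc (HahnSeries.single e z) = HahnSeries.single (c * e) z :=
  HahnSeries.embDomain_single

/-- The character `e ↦ exp (2 π i k e)` of `ℚ`. -/
def chi (k : ℤ) (e : ℚ) : ℂ := Complex.exp (2 * Real.pi * Complex.I * (k * e))

theorem chi_ne_zero (k : ℤ) (e : ℚ) : chi k e ≠ 0 := Complex.exp_ne_zero _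

theorem chi_add (k : ℤ) (d e : ℚ) : chi k (d + e) = chi k d * chi k e := by
  rw [chi, chi, chi, ← Complex.exp_add]
  congr 1
  push_cast
  ring

theorem chi_add_left (k l : ℤ) (e : ℚ) : chi (k + l) e = chi k e * chi l e := by
  rw [chi, chi, chi, ← Complex.exp_add]
  congr 1
  push_cast
  ring

theorem chi_eq_one_iff (k : ℤ) (e : ℚ) : chi k e = 1 ↔ ∃ n : ℤ, (k : ℚ) * e = n := by
  rw [chi, Complex.exp_eq_one_iff]
  have h : (2 * Real.pi * Complex.I : ℂ) ≠ 0 := Complex.two_pi_I_ne_zero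
  refine exists_congr fun n => ?_
  rw [mul_comm (n : ℂ), mul_right_inj' h]
  exact_mod_cast Iff.rfl

theorem norm_chi (k : ℤ) (e : ℚ) : ‖chi k e‖ = 1 := by
  rw [chi, show (2 * Real.pi * Complex.I * (k * e) : ℂ) =
    ((2 * Real.pi * (k * e) : ℝ) : ℂ) * Complex.I by push_cast; ring]
  exact Complex.norm_exp_ofReal_mul_I _

theorem chi_zero_right (k : ℤ) : chi k 0 = 1 := by simp [chi]

/-- The automorphism of the field of Hahn series which multiplies `y ^ e` by `exp (2 π i k e)`. -/
def conjHom (k : ℤ) : HahnSeries ℚ ℂ →+* HahnSeries ℚ ℂ where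
  toFun u :=
    { coeff := fun e => chi k e * u.coeff e
      isPWO_support' := u.isPWO_support.mono fun e he h => he (by
        change chi k e * u.coeff e = 0
        rw [h, mul_zero]) }
  map_zero' := by ext; simp
  map_one' := by
    ext e
    by_cases h : e = 0 <;> simp [HahnSeries.coeff_one, h, chi_zero_right]
  map_add' u v := by ext; simp [mul_add]
  map_mul' u v := by
    ext e
    have hs : ∀ w : HahnSeries ℚ ℂ, (fun e => chi k e * w.coeff e).support = w.support := by
      intro w
      ext e
      simp [chi_ne_zero]
    simp only [HahnSeries.coeff_mul, Finset.mul_sum]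
    refine Finset.sum_congr ?_ fun x hx => ?_
    · ext x
      simp [Finset.mem_antidiagonal, chi_ne_zero]
    · rw [← (Finset.mem_antidiagonal.1 hx).2.2, chi_add]
      ring

theorem coeff_conjHom (k : ℤ) (u : HahnSeries ℚ ℂ) (e : ℚ) :
    (conjHom k u).coeff e = chi k e * u.coeff e := rfl

theorem conjHom_conjHom (k l : ℤ) (u : HahnSeries ℚ ℂ) :
    conjHom k (conjHom l u) = conjHom (k + l) u := by
  ext e
  simp only [coeff_conjHom, chi_add_left, mul_assoc]

theorem conjHom_zero (u : HahnSeries ℚ ℂ) : conjHom 0 u = u := by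
  ext e
  simp [coeff_conjHom, chi]

theorem conjHom_single_intCast (k n : ℤ) (z : ℂ) :
    conjHom k (HahnSeries.single (n : ℚ) z) = HahnSeries.single (n : ℚ) z := by
  ext e
  rw [coeff_conjHom]
  by_cases h : e = n
  · rw [h, (chi_eq_one_iff k n).2 ⟨k * n, by push_cast; ring⟩, one_mul]
  · rw [HahnSeries.coeff_single_of_ne h, mul_zero]

theorem le_orderTop_iff {u : HahnSeries ℚ ℂ} {h : WithTop ℚ} :
    h ≤ u.orderTop ↔ ∀ e : ℚ, (e : WithTop ℚ) < h → u.coeff e = 0 := by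
  constructor
  · intro hu e he
    exact HahnSeries.coeff_eq_zero_of_lt_orderTop (he.trans_le hu)
  · intro hu
    by_contra! hlt
    obtain ⟨e, he⟩ := WithTop.ne_top_iff_exists.1 hlt.ne_top
    have h0 : u ≠ 0 := by
      rintro rfl
      simp at he
    rw [← HahnSeries.order_eq_orderTop_of_ne_zero h0] at hlt
    exact HahnSeries.leadingCoeff_ne_zero.2 h0 (by rw [HahnSeries.leadingCoeff_eq, hu _ hlt])

theorem orderTop_conjHom (k : ℤ) (u : HahnSeries ℚ ℂ) : (conjHom k u).orderTop = u.orderTop := by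
  refine eq_of_forall_le_iff fun h => ?_
  simp only [le_orderTop_iff, coeff_conjHom, mul_eq_zero, chi_ne_zero, false_or]

/-! ### Substitution as a ring homomorphism -/

theorem coeff_subst_eq_finsum (f : ConvSeries) {φ : HahnSeries ℚ ℂ} (hφ : 0 < φ.orderTop) (e : ℚ) :
    (subst f φ).coeff e = ∑ᶠ ij : ℕ × ℕ, coeffXY f ij.1 ij.2 *
      (φ ^ ij.1 * HahnSeries.single (1 : ℚ) (1 : ℂ) ^ ij.2).coeff e := by
  have hpos' : 0 < (HahnSeries.single (1 : ℚ) (1 : ℂ)).orderTop := by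
    rw [HahnSeries.orderTop_single one_ne_zero]
    exact_mod_cast one_pos
  rw [subst, HahnSeries.SummableFamily.hsum_smulFamily]
  refine finsum_congr fun ij => ?_
  simp only [HahnSeries.SummableFamily.mul, HahnSeries.SummableFamily.coe_mk,
      HahnSeries.SummableFamily.coe_powers hφ, HahnSeries.SummableFamily.coe_powers hpos',
      smul_eq_mul]

theorem hasSubst_pair {N : ℕ} (hN : 0 < (N : ℚ)) {a : PowerSeries ℂ}
    (ha0 : PowerSeries.constantCoeff a = 0) :
    MvPowerSeries.HasSubst ![a, (PowerSeries.X ^ N : PowerSeries ℂ)] := by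
  have hN' : N ≠ 0 := by
    rintro rfl
    simp at hN
  refine MvPowerSeries.hasSubst_of_constantCoeff_zero fun i => ?_
  fin_cases i
  · exact ha0
  · change PowerSeries.constantCoeff (PowerSeries.X ^ N : PowerSeries ℂ) = 0
    simp [hN']

/-- Once `y ↦ y ^ N` clears the denominators of `φ`, the substitution is the one for formal power
series, with `x ↦ a` and `y ↦ y ^ N`. The ring homomorphism laws of `substHom` are inherited from
there. -/
theorem powMap_subst (f : ConvSeries) {φ : HahnSeries ℚ ℂ} (hφ : 0 < φ.orderTop) {N : ℕ}
    (hN : 0 < (N : ℚ)) {a : PowerSeries ℂ} (ha0 : PowerSeries.constantCoeff a = 0)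
    (ha : powMap N hN φ = HahnSeries.ofPowerSeries ℚ ℂ a) :
    powMap N hN (subst f φ) = HahnSeries.ofPowerSeries ℚ ℂ
      (MvPowerSeries.subst ![a, (PowerSeries.X ^ N : PowerSeries ℂ)] f.1) := by
  have hs := hasSubst_pair hN ha0
  have key : ∀ i j : ℕ, powMap N hN (φ ^ i * HahnSeries.single (1 : ℚ) (1 : ℂ) ^ j) =
      HahnSeries.ofPowerSeries ℚ ℂ (a ^ i * (PowerSeries.X ^ N) ^ j) := by
    intro i j
    rw [map_mul, map_pow, map_pow, ha, powMap_single, map_mul, map_pow, map_pow,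
      HahnSeries.ofPowerSeries_X_pow, mul_one]
  ext e
  rw [coeff_powMap, coeff_subst_eq_finsum f hφ]
  simp only [← coeff_powMap hN, key]
  by_cases h : ∃ n : ℕ, e = n
  · obtain ⟨n, rfl⟩ := h
    rw [HahnSeries.ofPowerSeries_apply_coeff]
    simp only [HahnSeries.ofPowerSeries_apply_coeff]
    refine Eq.trans ?_ (MvPowerSeries.coeff_subst hs f.1 (Finsupp.single () n)).symm
    refine (finsum_eq_of_bijective (fun k : Fin 2 →₀ ℕ => (k 0, k 1)) ⟨?_, ?_⟩ ?_).symm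
    · intro k l hkl
      simp only [Prod.mk.injEq] at hkl
      ext i
      fin_cases i
      · exact hkl.1
      · exact hkl.2
    · intro ij
      exact ⟨Finsupp.single 0 ij.1 + Finsupp.single 1 ij.2, by simp⟩
    · intro k
      rw [coeff_eq_coeffXY, smul_eq_mul]
      congr 1
      rw [Finsupp.prod_fintype _ _ (by simp), Fin.prod_univ_two]
      rfl
  · push Not at h
    rw [ofPowerSeries_coeff _ e h]
    simp only [ofPowerSeries_coeff _ e h, mul_zero, finsum_zero]

/-- Conjugation is a field automorphism that fixes `y`, whose exponent is an integer, so it acts on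
`f(φ(y), y)` through `φ` alone. -/
theorem conjHom_subst (f : ConvSeries) {φ : HahnSeries ℚ ℂ} (hφ : 0 < φ.orderTop) (k : ℤ) :
    subst f (conjHom k φ) = conjHom k (subst f φ) := by
  ext e
  rw [coeff_subst_eq_finsum f (by rwa [orderTop_conjHom]), coeff_conjHom, coeff_subst_eq_finsum f hφ]
  have hy : HahnSeries.single (1 : ℚ) (1 : ℂ) = conjHom k (HahnSeries.single (1 : ℚ) (1 : ℂ)) := by
    have := conjHom_single_intCast k 1 1
    rw [Int.cast_one] at this
    exact this.symm
  rw [mul_finsum]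
  · refine finsum_congr fun ij => ?_
    conv_lhs => rw [hy]
    rw [← map_pow, ← map_pow, ← map_mul, coeff_conjHom]
    ring

theorem powMap_injective {c : ℚ} (hc : 0 < c) : Function.Injective (powMap c hc) :=
  RingHom.injective _

/-! ### The ring of convergent Puiseux series -/

theorem mem_range_inclHahn {u : HahnSeries ℚ ℂ} :
    u ∈ inclHahn.range ↔ (∀ e, u.coeff e ≠ 0 → ∃ n : ℕ, e = n) ∧
      ∃ r : ℝ, 0 < r ∧ Summable fun n : ℕ => ‖u.coeff n‖ * r ^ n := by
  constructor
  · rintro ⟨a, rfl⟩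
    refine ⟨fun e he => ?_, ?_⟩
    · by_contra! h
      exact he (ofPowerSeries_coeff a.1 e h)
    · obtain ⟨r, hr, h⟩ := mem_convSubring₁.1 a.2
      refine ⟨r, hr, h.congr fun n => ?_⟩
      rw [← HahnSeries.ofPowerSeries_apply_coeff (Γ := ℚ)]
      rfl
  · rintro ⟨h1, r, hr, h2⟩
    refine ⟨⟨PowerSeries.mk fun n => u.coeff n, mem_convSubring₁.2 ⟨r, hr, ?_⟩⟩, ?_⟩
    · simpa using h2
    · ext e
      by_cases he : ∃ n : ℕ, e = n
      · obtain ⟨n, rfl⟩ := he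
        exact (HahnSeries.ofPowerSeries_apply_coeff _ n).trans (PowerSeries.coeff_mk n fun n => u.coeff n)
      · rw [not_imp_comm.1 (h1 e) he]
        push Not at he
        exact ofPowerSeries_coeff _ e he

/-- The condition that `u` is a convergent power series in `y ^ (1 / N)`. -/
def IsPuiseuxOf (N : ℕ) (u : HahnSeries ℚ ℂ) : Prop :=
  ∃ hN : 0 < (N : ℚ), powMap N hN u ∈ inclHahn.range

theorem isPuiseuxOf_iff {N : ℕ} {u : HahnSeries ℚ ℂ} :
    IsPuiseuxOf N u ↔ 0 < N ∧ (∀ e, u.coeff e ≠ 0 → ∃ n : ℕ, e = (n : ℚ) / N) ∧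
      ∃ r : ℝ, 0 < r ∧ Summable fun n : ℕ => ‖u.coeff ((n : ℚ) / N)‖ * r ^ n := by
  unfold IsPuiseuxOf
  rw [← Nat.cast_pos (α := ℚ)]
  constructor
  · rintro ⟨hN, h⟩
    rw [mem_range_inclHahn] at h
    refine ⟨hN, fun e he => ?_, ?_⟩
    · obtain ⟨n, hn⟩ := h.1 (e * N) (by rwa [coeff_powMap, mul_div_cancel_right₀ _ hN.ne'])
      exact ⟨n, by rw [← hn, mul_div_cancel_right₀ _ hN.ne']⟩
    · simpa only [coeff_powMap] using h.2
  · rintro ⟨hN, h1, h2⟩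
    refine ⟨hN, mem_range_inclHahn.2 ⟨fun e he => ?_, ?_⟩⟩
    · rw [coeff_powMap] at he
      obtain ⟨n, hn⟩ := h1 _ he
      exact ⟨n, by field_simp at hn; exact hn⟩
    · simpa only [coeff_powMap] using h2

theorem IsPuiseuxOf.mul_left {N M : ℕ} {u : HahnSeries ℚ ℂ} (hu : IsPuiseuxOf N u) (hM : 0 < M) :
    IsPuiseuxOf (M * N) u := by
  obtain ⟨hN, h1, r, hr, h2⟩ := isPuiseuxOf_iff.1 hu
  refine isPuiseuxOf_iff.2 ⟨by positivity, fun e he => ?_, ?_⟩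
  · obtain ⟨n, rfl⟩ := h1 e he
    refine ⟨M * n, ?_⟩
    push_cast
    field_simp
  -- The index `n` becomes `M * n`; a radius at most `1` ensures that the larger power is no larger.
  · have hr1 : 0 < min r 1 := lt_min hr one_pos
    refine ⟨min r 1, hr1, ?_⟩
    rw [← (mul_right_injective₀ hM.ne').summable_iff]
    · refine Summable.of_nonneg_of_le
        (fun _ => mul_nonneg (norm_nonneg _) (pow_nonneg hr1.le _)) (fun n => ?_) h2
      have h3 : (((M * n : ℕ) : ℚ) / (M * N : ℕ)) = (n : ℚ) / N := by
        push_cast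
        field_simp
      simp only [Function.comp_apply, h3]
      gcongr
      calc (min r 1) ^ (M * n) ≤ (min r 1) ^ n :=
            pow_le_pow_of_le_one (by positivity) (min_le_right _ _) (Nat.le_mul_of_pos_left _ hM)
        _ ≤ r ^ n := by gcongr; exact min_le_left _ _
    · intro n hn
      by_cases h : u.coeff ((n : ℚ) / (M * N : ℕ)) = 0
      · rw [h, norm_zero, zero_mul]
      · obtain ⟨l, hl⟩ := h1 _ h
        refine absurd ⟨l, ?_⟩ hn
        push_cast at hl
        field_simp at hl
        exact_mod_cast hl.symm

/-- The ring of convergent Puiseux series with nonnegative exponents. -/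
def puiseuxRing : Subring (HahnSeries ℚ ℂ) where
  carrier := {u | ∃ N, IsPuiseuxOf N u}
  zero_mem' := ⟨1, by simp, by rw [map_zero]; exact zero_mem _⟩
  one_mem' := ⟨1, by simp, by rw [map_one]; exact one_mem _⟩
  add_mem' := by
    rintro u v ⟨N, hu⟩ ⟨M, hv⟩
    obtain ⟨h, hu'⟩ := hu.mul_left (isPuiseuxOf_iff.1 hv).1
    obtain ⟨_, hv'⟩ := hv.mul_left (isPuiseuxOf_iff.1 hu).1
    refine ⟨M * N, h, ?_⟩
    rw [map_add]
    exact add_mem hu' (by simpa only [mul_comm] using hv')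
  mul_mem' := by
    rintro u v ⟨N, hu⟩ ⟨M, hv⟩
    obtain ⟨h, hu'⟩ := hu.mul_left (isPuiseuxOf_iff.1 hv).1
    obtain ⟨_, hv'⟩ := hv.mul_left (isPuiseuxOf_iff.1 hu).1
    refine ⟨M * N, h, ?_⟩
    rw [map_mul]
    exact mul_mem hu' (by simpa only [mul_comm] using hv')
  neg_mem' := by
    rintro u ⟨N, h, hu⟩
    refine ⟨N, h, ?_⟩
    rw [map_neg]
    exact neg_mem hu

theorem orderTop_nonneg_of_mem {u : HahnSeries ℚ ℂ} (hu : u ∈ puiseuxRing) : 0 ≤ u.orderTop := by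
  obtain ⟨N, hN⟩ := hu
  obtain ⟨hN0, h, -⟩ := isPuiseuxOf_iff.1 hN
  refine le_orderTop_iff.2 fun e he => ?_
  by_contra hne
  obtain ⟨n, rfl⟩ := h e hne
  have : ((n : ℚ) / N) < 0 := by exact_mod_cast he
  have h2 : 0 ≤ (n : ℚ) / N := by positivity
  linarith

theorem isFractional_iff {u : HahnSeries ℚ ℂ} :
    IsFractional u ↔ u ∈ puiseuxRing ∧ u.coeff 0 = 0 := by
  constructor
  · rintro ⟨N, hN, h1, h2⟩
    refine ⟨⟨N, isPuiseuxOf_iff.2 ⟨hN, fun e he => ?_, h2⟩⟩, ?_⟩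
    · obtain ⟨n, -, hn⟩ := h1 e he
      exact ⟨n, hn⟩
    · by_contra h
      obtain ⟨n, hn, h0⟩ := h1 0 h
      have : (0 : ℚ) < n / N := by positivity
      linarith
  · rintro ⟨⟨N, hN⟩, h0⟩
    obtain ⟨hN, h1, h2⟩ := isPuiseuxOf_iff.1 hN
    refine ⟨N, hN, fun e he => ?_, h2⟩
    obtain ⟨n, rfl⟩ := h1 e he
    refine ⟨n, Nat.pos_of_ne_zero ?_, rfl⟩
    rintro rfl
    simp [h0] at he

theorem FracSeries.orderTop_pos (γ : FracSeries) : 0 < γ.1.orderTop :=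
  KuoLu.orderTop_pos fun _ he => γ.pos_of_coeff_ne_zero he

theorem FracSeries.mem (γ : FracSeries) : γ.1 ∈ puiseuxRing := (isFractional_iff.1 γ.2).1

theorem FracSeries.exists_powMap (γ : FracSeries) : ∃ (N : ℕ) (hN : 0 < (N : ℚ))
    (a : ConvSeries₁), PowerSeries.constantCoeff a.1 = 0 ∧ powMap N hN γ.1 = inclHahn a := by
  obtain ⟨⟨N, hN, a, ha⟩, h0⟩ := isFractional_iff.1 γ.2
  refine ⟨N, hN, a, ?_, ha.symm⟩
  rw [← PowerSeries.coeff_zero_eq_constantCoeff_apply,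
    ← HahnSeries.ofPowerSeries_apply_coeff (Γ := ℚ)]
  change (inclHahn a).coeff _ = 0
  rw [ha, coeff_powMap]
  simpa using h0

/-- Substitution of a fractional power series for `x`, as a ring homomorphism. -/
def substHom (γ : FracSeries) : ConvSeries →+* HahnSeries ℚ ℂ where
  toFun f := subst f γ.1
  map_zero' := by
    ext e
    rw [coeff_subst_eq_finsum _ γ.orderTop_pos]
    simp [coeffXY]
  map_add' f g := by
    obtain ⟨N, hN, a, ha0, ha⟩ := γ.exists_powMap
    refine powMap_injective hN ?_
    rw [map_add, powMap_subst _ γ.orderTop_pos hN ha0 ha, powMap_subst _ γ.orderTop_pos hN ha0 ha,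
      powMap_subst _ γ.orderTop_pos hN ha0 ha, ← map_add, ← MvPowerSeries.subst_add]
    · rfl
    · exact hasSubst_pair hN ha0
  map_one' := by
    obtain ⟨N, hN, a, ha0, ha⟩ := γ.exists_powMap
    refine powMap_injective hN ?_
    rw [powMap_subst _ γ.orderTop_pos hN ha0 ha,
      ← MvPowerSeries.coe_substAlgHom (hasSubst_pair hN ha0)]
    change HahnSeries.ofPowerSeries ℚ ℂ (MvPowerSeries.substAlgHom _ 1) = _
    rw [map_one, map_one, map_one]
  map_mul' f g := by
    obtain ⟨N, hN, a, ha0, ha⟩ := γ.exists_powMap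
    refine powMap_injective hN ?_
    rw [map_mul, powMap_subst _ γ.orderTop_pos hN ha0 ha, powMap_subst _ γ.orderTop_pos hN ha0 ha,
      powMap_subst _ γ.orderTop_pos hN ha0 ha, ← map_mul, ← MvPowerSeries.subst_mul]
    · rfl
    · exact hasSubst_pair hN ha0

theorem substHom_apply (γ : FracSeries) (f : ConvSeries) : substHom γ f = subst f γ.1 := rfl

theorem mem_Zer {γ : FracSeries} {f : ConvSeries} : γ ∈ Zer f ↔ substHom γ f = 0 := Iff.rfl

/-! ### Polynomials in `x` over `ℂ{y}` -/

/-- The convergent power series `x`. -/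
def varX : ConvSeries :=
  ⟨MvPowerSeries.monomial (Finsupp.single 0 1) 1, isConvergent_monomial _ _⟩

/-- The inclusion of `ℂ{y}[x]` into `ℂ{x, y}`. -/
def polyToConv : ConvSeries₁[X] →+* ConvSeries := eval₂RingHom inclY varX

theorem coeffXY_polyToConv (P : ConvSeries₁[X]) (i j : ℕ) :
    coeffXY (polyToConv P) i j = PowerSeries.coeff j (P.coeff i).1 := by
  classical
  induction P using Polynomial.induction_on' with
  | add p q hp hq =>
    rw [map_add, coeffXY_add, hp, hq, coeff_add]
    rfl
  | monomial n a =>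
    rw [polyToConv, coe_eval₂RingHom, eval₂_monomial, coeff_monomial]
    have h1 : (inclY a * varX ^ n : ConvSeries).1 =
        (inclY a).1 * MvPowerSeries.monomial (Finsupp.single 0 n) 1 := by
      change (inclY a).1 * (MvPowerSeries.monomial (Finsupp.single 0 1) (1 : ℂ)) ^ n = _
      rw [MvPowerSeries.monomial_pow, one_pow, Finsupp.smul_single, smul_eq_mul, mul_one]
    rw [coeffXY, h1, MvPowerSeries.coeff_mul_monomial, mul_one, coeff_eq_coeffXY, coeffXY_inclY]
    by_cases hn : n ≤ i
    · have h2 : Finsupp.single 0 n ≤ (Finsupp.single 0 i + Finsupp.single 1 j : Fin 2 →₀ ℕ) := by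
        intro l
        fin_cases l <;> simp [hn]
      rw [if_pos h2]
      by_cases h3 : n = i
      · subst h3
        simp
      · have h4 : i - n ≠ 0 := by omega
        simp [h3, h4]
    · rw [if_neg, if_neg (by omega)]
      · simp
      · intro h
        exact hn (by simpa using h 0)

/-- The coefficient of `x ^ i`, a convergent power series in `y`. -/
def xCoeff (f : ConvSeries) (i : ℕ) : ConvSeries₁ :=
  ⟨PowerSeries.mk fun j => coeffXY f i j, by
    obtain ⟨r, hr, h⟩ := f.2
    refine mem_convSubring₁.2 ⟨r, hr, ?_⟩
    have hinj : Function.Injective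
        fun j : ℕ => (Finsupp.single 0 i + Finsupp.single 1 j : Fin 2 →₀ ℕ) := by
      intro a b hab
      exact Finsupp.single_injective 1 (add_left_cancel hab)
    refine ((h.comp_injective hinj).mul_left ((r ^ i)⁻¹)).congr fun j => ?_
    simp only [Function.comp_apply, PowerSeries.coeff_mk, map_add, Finsupp.degree_single, pow_add,
      coeffXY]
    field_simp⟩

theorem exists_polyToConv_eq {r : ConvSeries} {m : ℕ} (hr : ∀ i j, m ≤ i → coeffXY r i j = 0) :
    ∃ P : ConvSeries₁[X], P.degree < m ∧ polyToConv P = r := by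
  refine ⟨∑ i : Fin m, C (xCoeff r i) * X ^ (i : ℕ), degree_sum_fin_lt _, ?_⟩
  refine ConvSeries.ext fun i j => ?_
  rw [coeffXY_polyToConv, finsetSum_coeff]
  simp only [coeff_C_mul, coeff_X_pow]
  by_cases h : i < m
  · rw [Finset.sum_eq_single ⟨i, h⟩]
    · simp [xCoeff]
    · intro b _ hb
      rw [if_neg, mul_zero]
      exact fun h => hb (Fin.ext h.symm)
    · simp
  · rw [hr i j (not_lt.1 h), Finset.sum_eq_zero]
    · simp
    · intro b _
      rw [if_neg, mul_zero]
      omega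

theorem coeffXY_mul_zero (f g : ConvSeries) (i : ℕ) :
    coeffXY (f * g) i 0 =
      ∑ p ∈ Finset.HasAntidiagonal.antidiagonal i, coeffXY f p.1 0 * coeffXY g p.2 0 := by
  classical
  have h : coeffXY (f * g) i 0 = MvPowerSeries.coeff (Finsupp.single 0 i) (f.1 * g.1) := by
    rw [coeffXY, Finsupp.single_zero, add_zero]
    rfl
  rw [h, MvPowerSeries.coeff_mul, Finsupp.antidiagonal_single, Finset.sum_map]
  refine Finset.sum_congr rfl fun p _ => ?_
  simp [coeffXY]

/-- Weierstrass preparation for convergent power series. -/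
theorem weierstrass_preparation (g : ConvSeries) {m : ℕ} (hlt : ∀ i < m, coeffXY g i 0 = 0)
    (hm : coeffXY g m 0 ≠ 0) :
    ∃ (q : ConvSeries) (P : ConvSeries₁[X]), P.Monic ∧ P.natDegree = m ∧ polyToConv P = q * g ∧
      coeffXY q 0 0 ≠ 0 ∧ ∀ i < m, PowerSeries.coeff 0 (P.coeff i).1 = 0 := by
  -- Dividing `x ^ m` by `g` gives `x ^ m - R = q * g` with `R` of degree below `m` in `x`.
  obtain ⟨q, r, hqr, hr⟩ := weierstrass_division (polyToConv (X ^ m)) g hlt hm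
  obtain ⟨R, hR, rfl⟩ := exists_polyToConv_eq hr
  have hP : polyToConv (X ^ m - R) = q * g := by rw [map_sub, hqr, add_sub_cancel_right]
  have hdeg : (X ^ m - R).degree = (m : WithBot ℕ) := by
    rw [degree_sub_eq_left_of_degree_lt, degree_X_pow]
    rwa [degree_X_pow]
  have hmon : (X ^ m - R).Monic := monic_X_pow_sub hR
  refine ⟨q, X ^ m - R, hmon, natDegree_eq_of_degree_eq_some hdeg, hP, ?_, ?_⟩
  -- On `y = 0` the coefficient of `x ^ m` in `q * g` is `q(0, 0)` times that of `g`, and it must be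
  -- `1`.
  · intro h0
    have h1 : coeffXY (q * g) m 0 = 1 := by
      rw [← hP, coeffXY_polyToConv]
      have : (X ^ m - R).coeff m = 1 := by
        have := hmon.coeff_natDegree
        rwa [natDegree_eq_of_degree_eq_some hdeg] at this
      rw [this]
      exact PowerSeries.coeff_zero_one
    rw [coeffXY_mul_zero, Finset.sum_eq_zero] at h1
    · exact zero_ne_one h1
    · intro p hp
      have := Finset.HasAntidiagonal.mem_antidiagonal.1 hp
      rcases Nat.eq_zero_or_pos p.1 with h | h
      · rw [h, h0, zero_mul]
      · rw [hlt p.2 (by omega), mul_zero]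
  · intro i hi
    rw [← coeffXY_polyToConv, hP, coeffXY_mul_zero]
    refine Finset.sum_eq_zero fun p hp => ?_
    have := Finset.HasAntidiagonal.mem_antidiagonal.1 hp
    rw [hlt p.2 (by omega), mul_zero]

/-! ### Orders and constant terms of substituted series -/

theorem pow_mul_single_orderTop_pos {φ : HahnSeries ℚ ℂ} (hφ : 0 < φ.orderTop) {i j : ℕ}
    (h : i ≠ 0 ∨ j ≠ 0) :
    0 < (φ ^ i * HahnSeries.single (1 : ℚ) (1 : ℂ) ^ j).orderTop := by
  have key : ∀ {u : HahnSeries ℚ ℂ}, 0 < u.orderTop → ∀ n : ℕ,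
      0 ≤ (u ^ n).orderTop ∧ (n ≠ 0 → 0 < (u ^ n).orderTop) := by
    intro u hu n
    induction n with
    | zero => simp
    | succ n ih =>
      have : 0 < (u ^ (n + 1)).orderTop := by
        rw [pow_succ, HahnSeries.orderTop_mul]
        exact hu.trans_le (le_add_of_nonneg_left ih.1)
      exact ⟨this.le, fun _ => this⟩
  have hy : 0 < (HahnSeries.single (1 : ℚ) (1 : ℂ)).orderTop := by
    rw [HahnSeries.orderTop_single one_ne_zero]
    exact_mod_cast one_pos
  rw [HahnSeries.orderTop_mul]
  rcases h with h | h
  · exact ((key hφ i).2 h).trans_le (le_add_of_nonneg_right (key hy j).1)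
  · exact ((key hy j).2 h).trans_le (le_add_of_nonneg_left (key hφ i).1)

theorem substHom_coeff_zero (γ : FracSeries) (f : ConvSeries) :
    (substHom γ f).coeff 0 = coeffXY f 0 0 := by
  rw [substHom_apply, coeff_subst_eq_finsum f γ.orderTop_pos, finsum_eq_single _ (0, 0)]
  · simp
  · intro ij hij
    have h : ij.1 ≠ 0 ∨ ij.2 ≠ 0 := by
      by_contra! h
      exact hij (Prod.ext h.1 h.2)
    rw [HahnSeries.coeff_eq_zero_of_lt_orderTop
      (pow_mul_single_orderTop_pos γ.orderTop_pos h), mul_zero]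

theorem substHom_orderTop_nonneg (γ : FracSeries) (f : ConvSeries) :
    0 ≤ (substHom γ f).orderTop := by
  refine le_orderTop_iff.2 fun e he => ?_
  rw [substHom_apply, coeff_subst_eq_finsum f γ.orderTop_pos]
  refine finsum_eq_zero_of_forall_eq_zero fun ij => ?_
  by_cases h : ij.1 ≠ 0 ∨ ij.2 ≠ 0
  · rw [HahnSeries.coeff_eq_zero_of_lt_orderTop
      (he.trans (pow_mul_single_orderTop_pos γ.orderTop_pos h)), mul_zero]
  · push Not at h
    have he' : e ≠ 0 := by
      rintro rfl
      exact lt_irrefl _ he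
    simp [h.1, h.2, HahnSeries.coeff_one, he']

/-- The cofactor in Weierstrass preparation is of this kind, so it affects neither the roots nor the
orders along fractional power series. -/
theorem substHom_orderTop_eq_zero (γ : FracSeries) {f : ConvSeries} (hf : coeffXY f 0 0 ≠ 0) :
    (substHom γ f).orderTop = 0 :=
  le_antisymm (HahnSeries.orderTop_le_of_coeff_ne_zero (by rwa [substHom_coeff_zero]))
    (substHom_orderTop_nonneg γ f)

theorem substHom_varX (γ : FracSeries) : substHom γ varX = γ.1 := by
  classical
  have hX : ∀ i j, coeffXY varX i j = if i = 1 ∧ j = 0 then 1 else 0 := by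
    intro i j
    rw [coeffXY, varX, MvPowerSeries.coeff_monomial]
    refine if_congr ?_ rfl rfl
    rw [Finsupp.ext_iff, Fin.forall_fin_two]
    simp
  ext e
  rw [substHom_apply, coeff_subst_eq_finsum _ γ.orderTop_pos, finsum_eq_single _ (1, 0)]
  · simp [hX]
  · intro ij hij
    rw [hX, if_neg, zero_mul]
    rintro ⟨h1, h2⟩
    exact hij (Prod.ext h1 h2)

theorem substHom_inclY (γ : FracSeries) (a : ConvSeries₁) : substHom γ (inclY a) = inclHahn a := by
  ext e
  rw [substHom_apply, coeff_subst_eq_finsum _ γ.orderTop_pos]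
  by_cases he : ∃ n : ℕ, e = n
  · obtain ⟨n, rfl⟩ := he
    rw [finsum_eq_single _ (0, n)]
    · rw [coeffXY_inclY, if_pos rfl, pow_zero, one_mul, HahnSeries.single_pow]
      simpa [inclHahn] using (HahnSeries.ofPowerSeries_apply_coeff a.1 n).symm
    · intro ij hij
      rw [coeffXY_inclY]
      split_ifs with h
      · rw [h, pow_zero, one_mul, HahnSeries.single_pow, HahnSeries.coeff_single_of_ne, mul_zero]
        intro h2
        refine hij (Prod.ext h ?_)
        simpa using h2.symm
      · rw [zero_mul]
  · push Not at he
    refine (finsum_eq_zero_of_forall_eq_zero fun ij => ?_).trans (ofPowerSeries_coeff a.1 e he).symm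
    rw [coeffXY_inclY]
    split_ifs with h
    · rw [h, pow_zero, one_mul, HahnSeries.single_pow, HahnSeries.coeff_single_of_ne, mul_zero]
      simpa using he ij.2
    · rw [zero_mul]

theorem substHom_polyToConv (γ : FracSeries) (P : ConvSeries₁[X]) :
    substHom γ (polyToConv P) = P.eval₂ inclHahn γ.1 := by
  rw [polyToConv, coe_eval₂RingHom, hom_eval₂, substHom_varX]
  congr 1
  ext1 a
  exact substHom_inclY γ a

/-! ### The Newton-Puiseux theorem -/

/-- With the denominator of `e` absorbed into `N`, multiplication by `y ^ e` shifts the index by an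
integer, which only costs a constant factor in the summability. Negative `e` is what the Newton
polygon rescaling requires. -/
theorem single_mul_mem {u : HahnSeries ℚ ℂ} (hu : u ∈ puiseuxRing) {e : ℚ}
    (he : ((-e : ℚ) : WithTop ℚ) ≤ u.orderTop) : HahnSeries.single e 1 * u ∈ puiseuxRing := by
  obtain ⟨N₀, hN₀⟩ := hu
  have hN := hN₀.mul_left e.pos
  set N := e.den * N₀ with hNdef
  obtain ⟨hN0, h1, r, hr, h2⟩ := isPuiseuxOf_iff.1 hN
  obtain ⟨k, hk⟩ : ∃ k : ℤ, e = k / N := by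
    refine ⟨e.num * N₀, ?_⟩
    have hd : (e.den : ℚ) ≠ 0 := by exact_mod_cast e.den_nz
    have hn : (N₀ : ℚ) ≠ 0 := by exact_mod_cast (isPuiseuxOf_iff.1 hN₀).1.ne'
    rw [hNdef]
    push_cast
    rw [mul_div_mul_right _ _ hn]
    exact (Rat.num_div_den e).symm
  have hNq : (0 : ℚ) < N := by exact_mod_cast hN0
  refine ⟨N, isPuiseuxOf_iff.2 ⟨hN0, fun x hx => ?_, r, hr, ?_⟩⟩
  · rw [HahnSeries.coeff_single_mul, one_mul] at hx
    obtain ⟨n, hn⟩ := h1 _ hx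
    have h3 : ((-e : ℚ) : WithTop ℚ) ≤ ((x - e : ℚ) : WithTop ℚ) :=
      he.trans (HahnSeries.orderTop_le_of_coeff_ne_zero hx)
    have h4 : -e ≤ x - e := by exact_mod_cast h3
    have h5 : x = ((n + k : ℤ) : ℚ) / N := by
      push_cast
      rw [add_div, ← hn, ← hk]
      ring
    have h6 : 0 ≤ (n + k : ℤ) := by
      have : (0 : ℚ) ≤ ((n + k : ℤ) : ℚ) := by
        have h7 : 0 ≤ x := by linarith
        rw [h5] at h7
        by_contra! h8
        exact absurd (div_neg_of_neg_of_pos h8 hNq) (not_lt.2 h7)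
      exact_mod_cast this
    refine ⟨(n + k : ℤ).toNat, ?_⟩
    rw [h5]
    congr 1
    exact_mod_cast (Int.toNat_of_nonneg h6).symm
  · simp only [HahnSeries.coeff_single_mul, one_mul]
    obtain ⟨p, rfl | rfl⟩ := k.eq_nat_or_neg
    · rw [← summable_nat_add_iff p]
      refine (h2.mul_right (r ^ p)).congr fun n => ?_
      have : (((n + p : ℕ) : ℚ) / N - e) = (n : ℚ) / N := by
        rw [hk]
        push_cast
        ring
      rw [this, pow_add, mul_assoc]
    · rw [← summable_nat_add_iff p] at h2
      refine (h2.mul_right ((r ^ p)⁻¹)).congr fun n => ?_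
      have : ((n : ℚ) / N - e) = ((n + p : ℕ) : ℚ) / N := by
        rw [hk]
        push_cast
        ring
      rw [this, pow_add]
      field_simp

theorem single_mem {e : ℚ} (he : 0 ≤ e) : HahnSeries.single e (1 : ℂ) ∈ puiseuxRing := by
  have := single_mul_mem (one_mem puiseuxRing) (e := e) (by
    rw [HahnSeries.orderTop_one]
    exact_mod_cast neg_nonpos.2 he)
  rwa [mul_one] at this

theorem C_mem (z : ℂ) : HahnSeries.C z ∈ puiseuxRing := by
  refine ⟨1, isPuiseuxOf_iff.2 ⟨one_pos, fun e he => ⟨0, ?_⟩, 1, one_pos, ?_⟩⟩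
  · by_contra h
    refine he (HahnSeries.coeff_single_of_ne ?_)
    simpa using h
  · refine summable_of_ne_finset_zero (s := {0}) fun n hn => ?_
    have : ((n : ℚ) / (1 : ℕ)) ≠ 0 := by simpa using hn
    rw [show (HahnSeries.C z).coeff ((n : ℚ) / (1 : ℕ)) = 0 from
      HahnSeries.coeff_single_of_ne this]
    simp

/-- The inclusion of `ℂ{y}` into the ring of convergent Puiseux series. -/
def inclPuiseux : ConvSeries₁ →+* puiseuxRing :=
  inclHahn.codRestrict puiseuxRing fun a =>
    ⟨1, by simp, by
      refine ⟨a, ?_⟩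
      ext e
      rw [coeff_powMap]
      simp⟩

/-- The constant term, as a ring homomorphism. -/
def residue : puiseuxRing →+* ℂ where
  toFun u := u.1.coeff 0
  map_zero' := rfl
  map_one' := by simp
  map_add' _ _ := rfl
  map_mul' u v := by
    have h : ∀ w : puiseuxRing, StartsWith w.1 0 (w.1.coeff 0) := fun w =>
      ⟨fun e he => HahnSeries.coeff_eq_zero_of_lt_orderTop
        (lt_of_lt_of_le (by exact_mod_cast he) (orderTop_nonneg_of_mem w.2)), rfl⟩
    have := ((h u).mul (h v)).2
    rw [add_zero] at this
    exact this

theorem exists_common_isPuiseuxOf (P : puiseuxRing[X]) :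
    ∃ N : ℕ, 0 < N ∧ ∀ i, IsPuiseuxOf N (P.coeff i).1 := by
  have h : ∀ S : Finset ℕ, ∃ N : ℕ, 0 < N ∧ ∀ i ∈ S, IsPuiseuxOf N (P.coeff i).1 := by
    intro S
    induction S using Finset.cons_induction with
    | empty => exact ⟨1, one_pos, by simp⟩
    | cons i S hi ih =>
      obtain ⟨N, hN, h⟩ := ih
      obtain ⟨M, hM⟩ := (P.coeff i).2
      have hM0 := (isPuiseuxOf_iff.1 hM).1
      refine ⟨M * N, Nat.mul_pos hM0 hN, fun j hj => ?_⟩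
      rcases Finset.mem_cons.1 hj with rfl | hj
      · rw [mul_comm]
        exact hM.mul_left hN
      · exact (h j hj).mul_left hM0
  obtain ⟨N, hN, hP⟩ := h P.support
  refine ⟨N, hN, fun i => ?_⟩
  by_cases hi : i ∈ P.support
  · exact hP i hi
  · rw [notMem_support_iff.1 hi]
    exact ⟨by exact_mod_cast hN, by simp⟩

/-- If the reduction of `P` modulo `y` has order `m` at `0`, then a root of a distinguished
polynomial of degree `m` gives a root of `P`. -/
theorem exists_root_of_residue {P : puiseuxRing[X]} {m : ℕ} (hm0 : 0 < m)
    (hlt : ∀ i < m, residue (P.coeff i) = 0) (hm : residue (P.coeff m) ≠ 0)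
    (ih : ∀ Q : puiseuxRing[X], Q.Monic → Q.natDegree = m → ∃ a, Q.IsRoot a) :
    ∃ a, P.IsRoot a := by
  obtain ⟨N, hN, hPN⟩ := exists_common_isPuiseuxOf P
  have hNq : (0 : ℚ) < N := by exact_mod_cast hN
  set τ := powMap N hNq with hτ
  -- After `y ↦ y ^ N` the polynomial has coefficients in `ℂ{y}`, so Weierstrass preparation applies
  -- and replaces it by a distinguished polynomial `W` of degree `m`.
  obtain ⟨G, hG⟩ : ∃ G : ConvSeries₁[X],
      G.map inclHahn = (P.map puiseuxRing.subtype).map τ := by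
    rw [← mem_lifts, lifts_iff_coeff_lifts]
    intro n
    obtain ⟨_, a, ha⟩ := hPN n
    refine ⟨a, ?_⟩
    rw [coeff_map, coeff_map]
    exact ha
  have hcoef : ∀ i, coeffXY (polyToConv G) i 0 = residue (P.coeff i) := by
    intro i
    have h1 := congrArg (fun Q : (HahnSeries ℚ ℂ)[X] => (Q.coeff i).coeff 0) hG
    simp only [coeff_map, hτ, coeff_powMap, zero_div] at h1
    rw [coeffXY_polyToConv]
    refine Eq.trans ?_ h1
    have := HahnSeries.ofPowerSeries_apply_coeff (Γ := ℚ) (G.coeff i).1 0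
    rw [Nat.cast_zero] at this
    exact this.symm
  obtain ⟨q, W, hW, hWd, hqW, hq0, hW0⟩ := weierstrass_preparation (polyToConv G)
    (fun i hi => by rw [hcoef, hlt i hi]) (by rwa [hcoef])
  obtain ⟨a, ha⟩ := ih (W.map inclPuiseux) (hW.map inclPuiseux) (by rw [hW.natDegree_map, hWd])
  -- Modulo `y` the polynomial `W` is `X ^ m`, so its root has no constant term. The root is thus a
  -- fractional power series and can be substituted into `q * G`.
  have ha0 : residue a = 0 := by
    have h1 : (W.map inclPuiseux).map residue = X ^ m := by
      ext i
      rw [coeff_map, coeff_map, coeff_X_pow]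
      have h2 : residue (inclPuiseux (W.coeff i)) = PowerSeries.coeff 0 (W.coeff i).1 := by
        have := HahnSeries.ofPowerSeries_apply_coeff (Γ := ℚ) (W.coeff i).1 0
        rw [Nat.cast_zero] at this
        exact this
      rw [h2]
      rcases lt_trichotomy i m with h | h | h
      · rw [hW0 i h, if_neg h.ne]
      · rw [if_pos h, h, ← hWd, hW.coeff_natDegree]
        exact PowerSeries.coeff_zero_one
      · rw [if_neg h.ne', coeff_eq_zero_of_natDegree_lt (by omega)]
        exact map_zero _
    have h3 := congrArg residue ha
    rw [map_zero, ← eval₂_hom, ← eval_map, h1, eval_pow, eval_X] at h3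
    exact pow_eq_zero_iff hm0.ne' |>.1 h3
  let γ : FracSeries := ⟨a.1, isFractional_iff.2 ⟨a.2, ha0⟩⟩
  have h1 : substHom γ (polyToConv W) = 0 := by
    rw [substHom_polyToConv]
    have h2 := congrArg puiseuxRing.subtype ha
    rw [eval_map, map_zero, hom_eval₂] at h2
    exact h2
  rw [hqW, map_mul] at h1
  have h2 : substHom γ (polyToConv G) = 0 := by
    refine (mul_eq_zero.1 h1).resolve_left fun h => hq0 ?_
    rw [← substHom_coeff_zero γ, h]
    rfl
  rw [substHom_polyToConv, ← eval_map, hG] at h2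
  have hinv : ∀ u, τ (powMap (N : ℚ)⁻¹ (inv_pos.2 hNq) u) = u := by
    intro u
    ext e
    rw [hτ, coeff_powMap, coeff_powMap]
    congr 1
    field_simp
  obtain ⟨N', hN', hr⟩ := a.2
  -- The root of `P` is `a(y ^ (1 / N))`, whose denominators divide `N' * N`.
  refine ⟨⟨powMap (N : ℚ)⁻¹ (inv_pos.2 hNq) a.1, N' * N, ?_, ?_⟩, ?_⟩
  · push_cast
    positivity
  · convert hr using 1
    ext e
    rw [coeff_powMap, coeff_powMap, coeff_powMap]
    congr 1
    push_cast
    field_simp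
  · refine Subtype.ext (powMap_injective hNq ?_)
    change τ (puiseuxRing.subtype (eval _ P)) = τ 0
    rw [map_zero, ← eval₂_hom, ← eval_map, ← eval₂_hom, ← eval_map]
    exact (congrArg (fun x => eval x _) (hinv a.1)).trans h2

theorem eq_pow_of_natTrailingDegree_eq {Q : ℂ[X]} (hQ : Q.Monic) (c : ℂ)
    (h : (Polynomial.taylor c Q).natTrailingDegree = Q.natDegree) : Q = (X - C c) ^ Q.natDegree := by
  have h1 : Polynomial.taylor c Q = X ^ Q.natDegree := by
    ext i
    rw [coeff_X_pow]
    rcases lt_trichotomy i Q.natDegree with h' | h' | h'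
    · rw [coeff_eq_zero_of_lt_natTrailingDegree (by omega), if_neg h'.ne]
    · rw [if_pos h', h', coeff_taylor_natDegree, hQ]
    · rw [if_neg h'.ne', coeff_eq_zero_of_natDegree_lt (by rwa [natDegree_taylor])]
  have h2 : Polynomial.taylor (-c) (Polynomial.taylor c Q) = Polynomial.taylor (-c) (X ^ Q.natDegree) := by rw [h1]
  rw [taylor_taylor, neg_add_cancel, taylor_zero, taylor_X_pow] at h2
  rw [C_neg, ← sub_eq_add_neg] at h2
  exact h2

theorem coeff_X_sub_C_pow_pred (c : ℂ) {d : ℕ} (hd : 0 < d) :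
    ((X - C c) ^ d).coeff (d - 1) = -(d * c) := by
  obtain ⟨k, rfl⟩ := Nat.exists_eq_succ_of_ne_zero hd.ne'
  rw [sub_eq_add_neg, ← C_neg, coeff_X_add_C_pow]
  simp [mul_comm]

/-- Newton-Puiseux: a monic polynomial of positive degree over the ring of convergent Puiseux
series has a root. -/
theorem exists_isRoot (d : ℕ) : ∀ P : puiseuxRing[X], P.Monic → P.natDegree = d → 0 < d →
    ∃ a, P.IsRoot a := by
  induction d using Nat.strong_induction_on with
  | _ d ih =>
  intro P₀ hP₀ hd₀ hd
  suffices H : ∀ P : puiseuxRing[X], P.Monic → P.natDegree = d → P.coeff (d - 1) = 0 →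
      ∃ a, P.IsRoot a by
    -- Tschirnhaus translation: a shift by minus the average of the roots kills the coefficient of
    -- `X ^ (d - 1)`.
    let t : puiseuxRing := -(⟨HahnSeries.C (d : ℂ)⁻¹, C_mem _⟩ * P₀.coeff (d - 1))
    have ht : (Polynomial.taylor t P₀).coeff (d - 1) = 0 := by
      have h1 : hasseDeriv (d - 1) P₀ = C ((d : puiseuxRing)) * X + C (P₀.coeff (d - 1)) := by
        ext1 i
        rw [hasseDeriv_coeff, coeff_add, coeff_C_mul_X, coeff_C]
        rcases i with _ | _ | i
        · simp
        · have : 0 + 1 + (d - 1) = d := by omega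
          rw [this, ← hd₀, hP₀.coeff_natDegree, hd₀]
          simp [Nat.choose_symm (show 1 ≤ d from hd)]
        · rw [coeff_eq_zero_of_natDegree_lt (by omega)]
          simp
      rw [taylor_coeff, h1]
      have h2 : (d : puiseuxRing) * ⟨HahnSeries.C (d : ℂ)⁻¹, C_mem _⟩ = 1 := by
        refine Subtype.ext ?_
        change ((d : puiseuxRing) : HahnSeries ℚ ℂ) * HahnSeries.C (d : ℂ)⁻¹ = 1
        have h3 : ((d : puiseuxRing) : HahnSeries ℚ ℂ) = HahnSeries.C (d : ℂ) := by simp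
        rw [h3, ← map_mul, mul_inv_cancel₀ (by exact_mod_cast hd.ne'), map_one]
      simp only [eval_add, eval_mul, eval_C, eval_X, t]
      linear_combination (-(P₀.coeff (d - 1))) * h2
    obtain ⟨a, ha⟩ := H (Polynomial.taylor t P₀) (by rwa [Monic, leadingCoeff_taylor])
      (by rwa [natDegree_taylor]) ht
    exact ⟨a + t, by rwa [IsRoot, taylor_eval] at ha⟩
  intro P hP hPd hP1
  by_cases hX : ∀ k < d, P.coeff k = 0
  · refine ⟨0, ?_⟩
    rw [IsRoot, ← coeff_zero_eq_eval_zero]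
    exact hX 0 hd
  push Not at hX
  obtain ⟨k₁, hk₁, hk₁'⟩ := hX
  -- The minimum of `ord (P_k) / (d - k)` is the slope `h` of the Newton polygon edge ending at `X ^
  -- d`.
  obtain ⟨k₀, hk₀, hmin⟩ := Finset.exists_min_image (P.support.erase d)
    (fun k => (P.coeff k).1.order / ((d - k : ℕ) : ℚ))
    ⟨k₁, Finset.mem_erase.2 ⟨hk₁.ne, mem_support_iff.2 hk₁'⟩⟩
  obtain ⟨h, hh⟩ : ∃ h : ℚ, h = (P.coeff k₀).1.order / ((d - k₀ : ℕ) : ℚ) := ⟨_, rfl⟩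
  rw [← hh] at hmin
  have hlt : ∀ k ∈ P.support.erase d, k < d := by
    intro k hk
    have h1 := Finset.mem_erase.1 hk
    have := le_natDegree_of_mem_supp k h1.2
    omega
  have hk₀d := hlt k₀ hk₀
  have hk₀ne : (P.coeff k₀).1 ≠ 0 := by
    have := mem_support_iff.1 (Finset.mem_erase.1 hk₀).2
    exact fun h => this (Subtype.ext h)
  have hh0 : 0 ≤ h := by
    rw [hh]
    refine div_nonneg ?_ (by positivity)
    have h1 := orderTop_nonneg_of_mem (P.coeff k₀).2
    rw [← HahnSeries.order_eq_orderTop_of_ne_zero hk₀ne] at h1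
    exact_mod_cast h1
  set PL := P.map puiseuxRing.subtype with hPL
  have hPLm : PL.Monic := hP.map _
  have hPLd : PL.natDegree = d := by rw [hPL, hP.natDegree_map, hPd]
  -- Dividing the roots by `y ^ h` multiplies the coefficient of `X ^ k` by `y ^ (-(d - k) h)`. By
  -- minimality all orders stay nonnegative, and the coefficient at `k₀` acquires a nonzero constant
  -- term.
  set QL := PL.scaleRoots (HahnSeries.single (-h) 1) with hQL
  have hQLc : ∀ k, QL.coeff k =
      HahnSeries.single (-(((d - k : ℕ) : ℚ) * h)) 1 * (P.coeff k).1 := by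
    intro k
    rw [hQL, coeff_scaleRoots, hPLd, HahnSeries.single_pow, one_pow, mul_comm, hPL, coeff_map,
      nsmul_eq_mul, mul_neg]
    rfl
  have hQLR : (QL.coeffs : Set (HahnSeries ℚ ℂ)) ⊆ puiseuxRing := by
    intro u hu
    obtain ⟨k, hk, rfl⟩ := mem_coeffs_iff.1 (Finset.mem_coe.1 hu)
    rw [hQLc]
    refine single_mul_mem (P.coeff k).2 ?_
    rw [neg_neg]
    by_cases hkd : k = d
    · rw [hkd, Nat.sub_self, Nat.cast_zero, zero_mul]
      exact orderTop_nonneg_of_mem (P.coeff d).2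
    by_cases hk0 : (P.coeff k).1 = 0
    · rw [hk0]
      simp
    have hks : k ∈ P.support.erase d :=
      Finset.mem_erase.2 ⟨hkd, mem_support_iff.2 fun h => hk0 (congrArg Subtype.val h)⟩
    have h1 := hmin k hks
    have h2 : (0 : ℚ) < ((d - k : ℕ) : ℚ) := by
      have := hlt k hks
      exact_mod_cast Nat.sub_pos_of_lt this
    rw [← HahnSeries.order_eq_orderTop_of_ne_zero hk0]
    rw [le_div_iff₀ h2, mul_comm] at h1
    exact_mod_cast h1
  set Q := QL.toSubring puiseuxRing hQLR with hQ
  have hQm : Q.Monic := (monic_toSubring _ _ _).2 ((monic_scaleRoots_iff _).2 hPLm)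
  have hQd : Q.natDegree = d := by
    rw [hQ, natDegree_toSubring, hQL, natDegree_scaleRoots, hPLd]
  have hQc : ∀ k, (Q.coeff k).1 = QL.coeff k := fun k => coeff_toSubring _ _ _
  set Qr := Q.map residue with hQr
  have hQrm : Qr.Monic := hQm.map _
  have hQrd : Qr.natDegree = d := by rw [hQr, hQm.natDegree_map, hQd]
  have hQr1 : Qr.coeff (d - 1) = 0 := by
    rw [hQr, coeff_map]
    change (Q.coeff (d - 1)).1.coeff 0 = 0
    rw [hQc, hQLc, hP1]
    simp
  have hQr0 : Qr.coeff k₀ ≠ 0 := by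
    rw [hQr, coeff_map]
    change (Q.coeff k₀).1.coeff 0 ≠ 0
    rw [hQc, hQLc, HahnSeries.coeff_single_mul, one_mul]
    have h2 : (0 : ℚ) < ((d - k₀ : ℕ) : ℚ) := by exact_mod_cast Nat.sub_pos_of_lt hk₀d
    have h3 : 0 - -(((d - k₀ : ℕ) : ℚ) * h) = (P.coeff k₀).1.order := by
      rw [hh]
      field_simp
      ring
    rw [h3, ← HahnSeries.leadingCoeff_eq]
    exact HahnSeries.leadingCoeff_ne_zero.2 hk₀ne
  obtain ⟨c, hc⟩ := IsAlgClosed.exists_root Qr (by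
    rw [degree_eq_natDegree hQrm.ne_zero, hQrd]
    exact_mod_cast hd.ne')
  set T := Polynomial.taylor c Qr with hT
  have hTne : T ≠ 0 := by
    rw [hT, Ne, taylor_eq_zero]
    exact hQrm.ne_zero
  set m := T.natTrailingDegree with hm
  have hm0 : 0 < m := by
    refine Nat.pos_of_ne_zero fun h0 => ?_
    rcases natTrailingDegree_eq_zero.1 h0 with h1 | h1
    · exact hTne h1
    · exact h1 (by rw [hT, taylor_coeff_zero]; exact hc)
  -- If `m = d`, the reduction is `(X - c) ^ d`. Its vanishing coefficient at `X ^ (d - 1)` forces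
  -- `c = 0`, so it is `X ^ d`, contradicting the nonzero coefficient at `k₀`. The induction
  -- therefore reaches a strictly smaller degree.
  have hmd : m < d := by
    refine lt_of_le_of_ne ?_ fun hmd => ?_
    · rw [← hQrd, ← natDegree_taylor Qr c]
      exact natTrailingDegree_le_natDegree _
    · have h1 := eq_pow_of_natTrailingDegree_eq hQrm c (by rw [hQrd]; exact hmd)
      rw [hQrd] at h1
      have h2 := hQr1
      rw [h1, coeff_X_sub_C_pow_pred c hd, neg_eq_zero, mul_eq_zero] at h2
      have h3 : c = 0 := h2.resolve_left (by exact_mod_cast hd.ne')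
      rw [h1, h3, C_0, sub_zero, coeff_X_pow, if_neg hk₀d.ne] at hQr0
      exact hQr0 rfl
  set cR : puiseuxRing := ⟨HahnSeries.C c, C_mem c⟩ with hcR
  have hcr : residue cR = c := by
    change (HahnSeries.C c).coeff 0 = c
    simp
  have hTmap : ∀ i, residue ((Polynomial.taylor cR Q).coeff i) = T.coeff i := by
    intro i
    rw [← coeff_map, map_taylor, hcr]
  obtain ⟨b, hb⟩ := exists_root_of_residue (P := Polynomial.taylor cR Q) hm0
    (fun i hi => by rw [hTmap, coeff_eq_zero_of_lt_natTrailingDegree hi])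
    (by rw [hTmap]; exact mt trailingCoeff_eq_zero.1 hTne)
    (fun W hW hWd => ih m hmd W hW hWd hm0)
  rw [IsRoot, taylor_eval] at hb
  refine ⟨⟨HahnSeries.single h 1, single_mem hh0⟩ * (b + cR), Subtype.ext ?_⟩
  have h1 : eval (b + cR).1 QL = 0 := by
    have := congrArg puiseuxRing.subtype hb
    rw [map_zero, ← eval₂_hom, ← eval_map, hQ, map_toSubring] at this
    exact this
  have h2 := scaleRoots_eval₂_mul (p := PL) (RingHom.id (HahnSeries ℚ ℂ))
    (HahnSeries.single h 1 * (b + cR).1) (HahnSeries.single (-h) 1)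
  rw [RingHom.id_apply, ← mul_assoc, HahnSeries.single_mul_single, neg_add_cancel, mul_one,
    HahnSeries.single_zero_one, one_mul] at h2
  change eval (b + cR).1 QL = _ * eval (HahnSeries.single h 1 * (b + cR).1) PL at h2
  rw [h1] at h2
  have h3 := (mul_eq_zero.1 h2.symm).resolve_left
    (pow_ne_zero _ (HahnSeries.single_ne_zero one_ne_zero))
  change puiseuxRing.subtype (eval _ P) = 0
  rw [← eval₂_hom, ← eval_map]
  exact h3

/-- A monic polynomial over the ring of convergent Puiseux series is a product of linear factors. -/
theorem exists_eq_prod (d : ℕ) : ∀ P : puiseuxRing[X], P.Monic → P.natDegree = d →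
    ∃ s : Multiset puiseuxRing, P = (s.map fun a => X - C a).prod := by
  induction d with
  | zero =>
    intro P hP hd
    exact ⟨0, by simpa using hP.natDegree_eq_zero.1 hd⟩
  | succ d ih =>
    intro P hP hd
    obtain ⟨a, ha⟩ := exists_isRoot (d + 1) P hP hd (Nat.succ_pos d)
    obtain ⟨Q, rfl⟩ := dvd_iff_isRoot.2 ha
    have hQ : Q.Monic := (monic_X_sub_C a).of_mul_monic_left hP
    rw [(monic_X_sub_C a).natDegree_mul hQ, natDegree_X_sub_C] at hd
    obtain ⟨s, rfl⟩ := ih Q hQ (by omega)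
    exact ⟨a ::ₘ s, by simp⟩

/-! ### Factorization of `f` along fractional power series -/

/-- Weierstrass preparation turns `f`, up to a unit, into a monic polynomial over `ℂ{y}`, which
splits by Newton-Puiseux. Consequently `ord f(γ(y), y)` is the sum of the orders of `γ - a` over `a`
in `s`. -/
theorem exists_factorization (f : ConvSeries) (hf : (restrictX f).order < ⊤) :
    ∃ s : Multiset puiseuxRing, ∀ γ : FracSeries, ∃ u : HahnSeries ℚ ℂ, u.orderTop = 0 ∧
      u * substHom γ f = (s.map fun a => γ.1 - a.1).prod := by
  obtain ⟨m, hm⟩ := ENat.ne_top_iff_exists.1 hf.ne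
  have h1 := PowerSeries.order_eq_nat.1 hm.symm
  obtain ⟨q, W, hW, -, hqW, hq, -⟩ := weierstrass_preparation f (m := m)
    (fun i hi => by simpa [restrictX] using h1.2 i hi) (by simpa [restrictX] using h1.1)
  obtain ⟨s, hs⟩ := exists_eq_prod _ (W.map inclPuiseux) (hW.map inclPuiseux) rfl
  refine ⟨s, fun γ => ⟨substHom γ q, substHom_orderTop_eq_zero γ hq, ?_⟩⟩
  rw [← map_mul, ← hqW, substHom_polyToConv]
  have h2 : W.eval₂ inclHahn γ.1 = (W.map inclPuiseux).eval₂ puiseuxRing.subtype γ.1 := by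
    rw [eval₂_map]
    rfl
  rw [h2, hs, ← coe_eval₂RingHom, map_multiset_prod, Multiset.map_map]
  simp

theorem finite_Zer (f : ConvSeries) (hf : (restrictX f).order < ⊤) : (Zer f).Finite := by
  classical
  obtain ⟨s, hs⟩ := exists_factorization f hf
  refine Set.Finite.of_finite_image (f := fun γ : FracSeries => γ.1)
    ((s.toFinset.image Subtype.val).finite_toSet.subset ?_) Subtype.val_injective.injOn
  rintro _ ⟨γ, hγ, rfl⟩
  obtain ⟨u, -, h⟩ := hs γ
  rw [mem_Zer.1 hγ, mul_zero, eq_comm, Multiset.prod_eq_zero_iff, Multiset.mem_map] at h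
  obtain ⟨a, ha, h0⟩ := h
  simp only [Finset.coe_image, Set.mem_image, Finset.mem_coe, Multiset.mem_toFinset]
  exact ⟨a, ha, (sub_eq_zero.1 h0).symm⟩

theorem orderTop_multiset_prod (s : Multiset (HahnSeries ℚ ℂ)) :
    s.prod.orderTop = (s.map HahnSeries.orderTop).sum := by
  induction s using Multiset.induction_on with
  | empty => simp
  | cons a s ih => rw [Multiset.prod_cons, HahnSeries.orderTop_mul, ih, Multiset.map_cons,
      Multiset.sum_cons]

/-! ### Roots of `F_B` -/

theorem PseudoBall.mem_carrier_iff {B : PseudoBall} {α γ : FracSeries} (hα : α ∈ B.carrier) :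
    γ ∈ B.carrier ↔ B.height ≤ contact γ α := by
  have key : ∀ β γ : FracSeries, B.height ≤ contact γ β ↔
      ∀ e : ℚ, (e : WithTop ℚ) < B.height → γ.1.coeff e = β.1.coeff e := by
    intro β γ
    rw [contact, le_orderTop_iff]
    simp only [HahnSeries.coeff_sub, sub_eq_zero]
  refine ⟨fun hγ => (key α γ).2 fun e he => PseudoBall.coeff_eq hα hγ he, fun hγ => ?_⟩
  obtain ⟨δ, hδ⟩ := B.exists_center
  rw [hδ] at hα ⊢
  exact (key δ γ).2 fun e he => ((key α γ).1 hγ e he).trans ((key δ α).1 hα e he)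

theorem PseudoBall.lam_mem (B : PseudoBall) : B.lam ∈ puiseuxRing := by
  obtain ⟨N, hN⟩ := B.center.mem
  obtain ⟨hN0, h1, r, hr, h2⟩ := isPuiseuxOf_iff.1 hN
  have h3 : ∀ e, B.lam.coeff e ≠ 0 → B.lam.coeff e = B.center.1.coeff e := by
    intro e he
    rw [PseudoBall.lam, HahnSeries.coeff_truncLT] at he ⊢
    split_ifs at he ⊢
    · rfl
    · exact absurd rfl he
  refine ⟨N, isPuiseuxOf_iff.2 ⟨hN0, fun e he => h1 e (h3 e he ▸ he), r, hr, ?_⟩⟩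
  refine Summable.of_nonneg_of_le (fun _ => by positivity) (fun n => ?_) h2
  gcongr
  by_cases h : B.lam.coeff ((n : ℚ) / N) = 0
  · rw [h, norm_zero]
    exact norm_nonneg _
  · rw [h3 _ h]

/-- The witness is `λ_B + z y ^ h` itself. The last clause lets two such witnesses be compared: they
differ only at the exponent `h`. -/
theorem PseudoBall.exists_mem_lc_eq {B : PseudoBall} {h : ℚ} (hB : B.height = h) (z : ℂ) :
    ∃ γ ∈ B.carrier, B.lc γ = z ∧ ∀ e ≠ h, γ.1.coeff e = B.lam.coeff e := by
  have hu : B.height.untopD 0 = h := by rw [hB]; rfl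
  have hpos : 0 < h := by
    have := B.height_pos
    rw [hB] at this
    exact_mod_cast this
  set u : HahnSeries ℚ ℂ := B.lam + HahnSeries.C z * HahnSeries.single h 1 with hudef
  have hCs : HahnSeries.C z * HahnSeries.single h 1 = HahnSeries.single h z := by
    rw [HahnSeries.C_apply, HahnSeries.single_mul_single, zero_add, mul_one]
  have hne : ∀ e ≠ h, u.coeff e = B.lam.coeff e := by
    intro e he
    rw [hudef, hCs, HahnSeries.coeff_add, HahnSeries.coeff_single_of_ne he, add_zero]
  have hl : B.lam.coeff h = 0 := by
    rw [PseudoBall.lam, hu]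
    exact HahnSeries.coeff_truncLT_of_le le_rfl _
  have hlt : ∀ e < h, B.lam.coeff e = B.center.1.coeff e := by
    intro e he
    rw [PseudoBall.lam, hu, HahnSeries.coeff_truncLT_of_lt he]
  have hu0 : u.coeff 0 = 0 := by
    rw [hne 0 hpos.ne, hlt 0 hpos]
    exact (isFractional_iff.1 B.center.2).2
  refine ⟨⟨u, isFractional_iff.2
    ⟨add_mem B.lam_mem (mul_mem (C_mem z) (single_mem hpos.le)), hu0⟩⟩, ?_, ?_, hne⟩
  · rw [PseudoBall.mem_carrier_iff B.center_mem, hB]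
    refine le_orderTop_iff.2 fun e he => ?_
    have he' : e < h := by exact_mod_cast he
    rw [HahnSeries.coeff_sub, sub_eq_zero]
    exact (hne e he'.ne).trans (hlt e he')
  · rw [PseudoBall.lc, hu]
    change u.coeff h = z
    rw [hudef, hCs, HahnSeries.coeff_add, hl, zero_add, HahnSeries.coeff_single_same]

theorem StartsWith.orderTop_eq {u : HahnSeries ℚ ℂ} {q : ℚ} {c : ℂ} (h : StartsWith u q c)
    (hc : c ≠ 0) : u.orderTop = q :=
  le_antisymm (HahnSeries.orderTop_le_of_coeff_ne_zero (by rwa [h.2]))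
    (le_orderTop_iff.2 fun e he => h.1 e (by exact_mod_cast he))

/-- Every root of `F_B` is the leading coefficient of a Newton-Puiseux root of `f` in `B`. -/
theorem exists_mem_Zer_lc_eq (f : ConvSeries) (hf : (restrictX f).order < ⊤) {B : PseudoBall}
    {h : ℚ} (hB : B.height = h) {c : ℂ} (hc : (FPoly f B).eval c = 0) :
    ∃ γ ∈ Zer f, γ ∈ B.carrier ∧ B.lc γ = c := by
  obtain ⟨q, -, hF, hstart⟩ := startsWith_subst f hf B (by rw [hB]; exact WithTop.coe_ne_top)
  obtain ⟨z, hz⟩ : ∃ z, (FPoly f B).eval z ≠ 0 := by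
    by_contra! hcon
    exact hF (Polynomial.funext fun z => by rw [hcon z, eval_zero])
  obtain ⟨γ₀, hγ₀B, hγ₀c, hγ₀⟩ := PseudoBall.exists_mem_lc_eq hB z
  obtain ⟨γ₁, hγ₁B, hγ₁c, hγ₁⟩ := PseudoBall.exists_mem_lc_eq hB c
  have hpos : 0 < h := by
    have := B.height_pos
    rw [hB] at this
    exact_mod_cast this
  obtain ⟨s, hs⟩ := exists_factorization f hf
  have hsum : ∀ γ, (substHom γ f).orderTop = (s.map fun a => (γ.1 - a.1).orderTop).sum := by
    intro γ
    obtain ⟨u, hu, h⟩ := hs γ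
    have := congrArg HahnSeries.orderTop h
    rwa [HahnSeries.orderTop_mul, hu, zero_add, orderTop_multiset_prod, Multiset.map_map] at this
  have hdiff : (h : WithTop ℚ) ≤ (γ₀.1 - γ₁.1).orderTop := by
    refine le_orderTop_iff.2 fun e he => ?_
    have he' : e ≠ h := by
      rintro rfl
      exact lt_irrefl _ he
    rw [HahnSeries.coeff_sub, hγ₀ e he', hγ₁ e he', sub_self]
  -- If no factor had contact above `h` with `γ₁`, replacing `γ₁` by `γ₀` would lower no factor's
  -- order, so `ord f(γ₁(y), y) ≤ ord f(γ₀(y), y) = q`. But `F_B(c) = 0` makes the former order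
  -- exceed `q`.
  obtain ⟨a, ha, hlt⟩ : ∃ a ∈ s, (h : WithTop ℚ) < (γ₁.1 - a.1).orderTop := by
    by_contra! hcon
    have h1 : (substHom γ₁ f).orderTop ≤ (substHom γ₀ f).orderTop := by
      rw [hsum, hsum]
      refine Multiset.sum_map_le_sum_map _ _ fun a ha => ?_
      have h2 : γ₀.1 - a.1 = (γ₀.1 - γ₁.1) + (γ₁.1 - a.1) := by ring
      rw [h2]
      refine le_trans (le_min ?_ le_rfl) HahnSeries.min_orderTop_le_orderTop_add
      exact (hcon a ha).trans hdiff
    have h3 := hstart γ₀ hγ₀B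
    rw [hγ₀c] at h3
    have h4 := hstart γ₁ hγ₁B
    rw [hγ₁c, hc] at h4
    rw [substHom_apply, substHom_apply, h3.orderTop_eq hz] at h1
    have h5 : (subst f γ₁.1).orderTop = q :=
      le_antisymm h1 (le_orderTop_iff.2 fun e he => h4.1 e (by exact_mod_cast he))
    exact HahnSeries.coeff_orderTop_ne h5 h4.2
  have hcoef : ∀ e ≤ h, a.1.coeff e = γ₁.1.coeff e := by
    intro e he
    have := HahnSeries.coeff_eq_zero_of_lt_orderTop
      (lt_of_le_of_lt (WithTop.coe_le_coe.2 he) hlt)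
    rw [HahnSeries.coeff_sub, sub_eq_zero] at this
    exact this.symm
  -- The series `a` agrees with `γ₁` up to and including the exponent `h`; hence it has no constant
  -- term, lies in `B` and has leading coefficient `c`.
  let γ : FracSeries := ⟨a.1, isFractional_iff.2 ⟨a.2, by
    rw [hcoef 0 hpos.le]
    exact (isFractional_iff.1 γ₁.2).2⟩⟩
  refine ⟨γ, ?_, ?_, ?_⟩
  · obtain ⟨u, hu, h⟩ := hs γ
    have h0 : (0 : HahnSeries ℚ ℂ) ∈ s.map fun a => γ.1 - a.1 :=
      Multiset.mem_map.2 ⟨a, ha, sub_self _⟩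
    rw [Multiset.prod_eq_zero h0] at h
    refine mem_Zer.2 ((mul_eq_zero.1 h).resolve_left ?_)
    rintro rfl
    simp at hu
  · rw [PseudoBall.mem_carrier_iff hγ₁B, hB]
    refine le_orderTop_iff.2 fun e he => ?_
    rw [HahnSeries.coeff_sub, sub_eq_zero]
    exact hcoef e (by exact_mod_cast he.le)
  · rw [← hγ₁c, PseudoBall.lc, PseudoBall.lc, hB]
    exact hcoef h le_rfl

/-! ### Conjugate fractional power series -/

theorem isPuiseuxOf_conjHom {N : ℕ} {u : HahnSeries ℚ ℂ} (hu : IsPuiseuxOf N u) (k : ℤ) :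
    IsPuiseuxOf N (conjHom k u) := by
  rw [isPuiseuxOf_iff] at hu ⊢
  simpa [coeff_conjHom, chi_ne_zero, norm_chi] using hu

/-- The conjugate of a fractional power series. -/
def FracSeries.conj (γ : FracSeries) (k : ℤ) : FracSeries :=
  ⟨conjHom k γ.1, isFractional_iff.2 ⟨γ.mem.imp fun _ h => isPuiseuxOf_conjHom h k, by
    rw [coeff_conjHom, (isFractional_iff.1 γ.2).2, mul_zero]⟩⟩

theorem substHom_conj (γ : FracSeries) (k : ℤ) (f : ConvSeries) :
    substHom (γ.conj k) f = conjHom k (substHom γ f) :=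
  conjHom_subst f γ.orderTop_pos k

theorem conjHom_eq_self {N : ℕ} {u : HahnSeries ℚ ℂ} (hu : IsPuiseuxOf N u) (k : ℤ) :
    conjHom (N * k) u = u := by
  obtain ⟨hN, h, -⟩ := isPuiseuxOf_iff.1 hu
  ext e
  rw [coeff_conjHom]
  by_cases he : u.coeff e = 0
  · rw [he, mul_zero]
  · obtain ⟨n, rfl⟩ := h e he
    rw [(chi_eq_one_iff _ _).2 ⟨k * n, by push_cast; field_simp⟩, one_mul]

theorem FracSeries.finite_range_conj (γ : FracSeries) : (Set.range γ.conj).Finite := by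
  obtain ⟨N, hN⟩ := γ.mem
  have hN0 : (0 : ℤ) < N := by exact_mod_cast (isPuiseuxOf_iff.1 hN).1
  refine ((Set.finite_Ico (0 : ℤ) N).image γ.conj).subset ?_
  rintro _ ⟨k, rfl⟩
  refine ⟨k % N, ⟨Int.emod_nonneg _ hN0.ne', Int.emod_lt_of_pos _ hN0⟩, Subtype.ext ?_⟩
  change conjHom (k % N) γ.1 = conjHom k γ.1
  conv_rhs => rw [← Int.emod_add_mul_ediv k N, ← conjHom_conjHom, conjHom_eq_self hN]

/-- Galois descent: `exp (2πi e) = 1` for every exponent `e` that occurs, so all exponents are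
integers. The radius becomes `r ^ N` since only indices divisible by `N` survive. -/
theorem mem_range_inclHahn_of_conjHom_eq {u : HahnSeries ℚ ℂ} (hu : u ∈ puiseuxRing)
    (h : conjHom 1 u = u) : u ∈ inclHahn.range := by
  obtain ⟨N, hN⟩ := hu
  obtain ⟨hN0, h1, r, hr, h2⟩ := isPuiseuxOf_iff.1 hN
  refine mem_range_inclHahn.2 ⟨fun e he => ?_, r ^ N, by positivity, ?_⟩
  · have h3 := congrArg (fun v : HahnSeries ℚ ℂ => v.coeff e) h
    simp only [coeff_conjHom] at h3
    obtain ⟨n, hn⟩ := (chi_eq_one_iff 1 e).1 (mul_right_cancel₀ he (by rw [h3, one_mul]))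
    rw [Int.cast_one, one_mul] at hn
    obtain ⟨m, hm⟩ := h1 e he
    have h4 : (0 : ℚ) ≤ n := by rw [← hn, hm]; positivity
    refine ⟨n.toNat, ?_⟩
    rw [hn]
    exact_mod_cast (Int.toNat_of_nonneg (by exact_mod_cast h4)).symm
  · refine (h2.comp_injective (mul_right_injective₀ hN0.ne')).congr fun n => ?_
    have : (((N * n : ℕ) : ℚ) / N) = n := by
      push_cast
      field_simp
    simp only [Function.comp_apply, this, pow_mul]

/-- The minimal polynomial of a fractional power series over `ℂ{y}` is an irreducible convergent
power series, which divides every convergent power series with that root, and whose roots are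
conjugate. -/
theorem exists_irreducible (γ : FracSeries) :
    ∃ g : ConvSeries, Irreducible g ∧ substHom γ g = 0 ∧ (∀ p, substHom γ p = 0 → g ∣ p) ∧
      ∀ δ, substHom δ g = 0 → ∃ k, δ = γ.conj k := by
  classical
  set S := γ.finite_range_conj.toFinset with hS
  have hmem : ∀ δ, δ ∈ S ↔ ∃ k, γ.conj k = δ := fun δ => by simp [hS]
  set GR : puiseuxRing[X] := ∏ δ ∈ S, (X - C ⟨δ.1, δ.mem⟩) with hGR
  set G : (HahnSeries ℚ ℂ)[X] := GR.map puiseuxRing.subtype with hG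
  have hGprod : G = ∏ δ ∈ S, (X - C δ.1) := by
    rw [hG, hGR, Polynomial.map_prod]
    simp
  -- Conjugation permutes the finite set of conjugates of `γ`, so the coefficients of their product
  -- polynomial are fixed and descend to `ℂ{y}`.
  have hconj : G.map (conjHom 1) = G := by
    rw [hGprod, Polynomial.map_prod]
    refine Finset.prod_bij (fun δ _ => δ.conj 1) ?_ ?_ ?_ ?_
    · intro δ hδ
      obtain ⟨k, rfl⟩ := (hmem δ).1 hδ
      exact (hmem _).2 ⟨1 + k, Subtype.ext (conjHom_conjHom 1 k γ.1).symm⟩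
    · intro a _ b _ hab
      exact Subtype.ext ((conjHom 1).injective (congrArg Subtype.val hab))
    · intro δ hδ
      obtain ⟨k, rfl⟩ := (hmem δ).1 hδ
      refine ⟨γ.conj (k - 1), (hmem _).2 ⟨_, rfl⟩, Subtype.ext ?_⟩
      refine (conjHom_conjHom 1 (k - 1) γ.1).trans ?_
      rw [add_sub_cancel]
      rfl
    · intro δ _
      simp [FracSeries.conj]
  obtain ⟨W, hW⟩ : ∃ W : ConvSeries₁[X], W.map inclHahn = G := by
    rw [← mem_lifts, lifts_iff_coeff_lifts]
    intro n
    refine mem_range_inclHahn_of_conjHom_eq ?_ ?_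
    · rw [hG, coeff_map]
      exact (GR.coeff n).2
    · rw [← coeff_map, hconj]
  have hcoef : ∀ i, coeffXY (polyToConv W) i 0 = if i = S.card then 1 else 0 := by
    intro i
    have h1 : GR.map residue = X ^ S.card := by
      rw [hGR, Polynomial.map_prod, Finset.prod_congr rfl (g := fun _ => X), Finset.prod_const]
      intro δ _
      have : residue ⟨δ.1, δ.mem⟩ = 0 := (isFractional_iff.1 δ.2).2
      simp [this]
    rw [coeffXY_polyToConv, ← coeff_X_pow, ← h1, coeff_map]
    change _ = (puiseuxRing.subtype (GR.coeff i)).coeff 0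
    rw [← coeff_map, ← hG, ← hW, coeff_map]
    have := HahnSeries.ofPowerSeries_apply_coeff (Γ := ℚ) (W.coeff i).1 0
    rw [Nat.cast_zero] at this
    exact this.symm
  set g := polyToConv W with hg
  have hsubst : ∀ δ, substHom δ g = ∏ ε ∈ S, (δ.1 - ε.1) := by
    intro δ
    rw [hg, substHom_polyToConv, ← eval_map, hW, hGprod, eval_prod]
    simp
  have hroot : substHom γ g = 0 := by
    rw [hsubst]
    refine Finset.prod_eq_zero (i := γ) ((hmem _).2 ⟨0, Subtype.ext (conjHom_zero _)⟩) (sub_self _)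
  have hdvd : ∀ p, substHom γ p = 0 → g ∣ p := by
    intro p hp
    obtain ⟨q, r, hqr, hr⟩ := weierstrass_division p g (m := S.card)
      (fun i hi => by rw [hcoef, if_neg hi.ne]) (by rw [hcoef, if_pos rfl]; exact one_ne_zero)
    obtain ⟨R, hR, rfl⟩ := exists_polyToConv_eq hr
    -- Conjugating `p(γ(y), y) = 0` shows that the remainder vanishes at all conjugates, which are
    -- more numerous than its degree allows.
    have hR0 : R.map inclHahn = 0 := by
      refine eq_zero_of_degree_lt_of_eval_index_eq_zero S (v := fun δ => δ.1)
        Subtype.val_injective.injOn ((degree_map_le).trans_lt hR) fun δ hδ => ?_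
      obtain ⟨k, rfl⟩ := (hmem δ).1 hδ
      have h1 := congrArg (substHom (γ.conj k)) hqr
      rw [substHom_conj, hp, map_zero, map_add, map_mul, substHom_conj γ k g, hroot, map_zero,
        mul_zero, zero_add, substHom_polyToConv] at h1
      rw [eval_map]
      exact h1.symm
    have : R = 0 := (Polynomial.map_eq_zero_iff inclHahn_injective).1 hR0
    rw [hqr, this, map_zero, add_zero]
    exact dvd_mul_left _ _
  have hg0 : g ≠ 0 := by
    intro h
    have h1 := hcoef S.card
    rw [if_pos rfl, h] at h1
    simp [coeffXY] at h1
  refine ⟨g, ⟨?_, ?_⟩, hroot, hdvd, ?_⟩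
  · intro hu
    have := hu.map (substHom γ)
    rw [hroot] at this
    exact not_isUnit_zero this
  -- A factor with root `γ` is divisible by `g`, so the complementary factor is a unit.
  · have key : ∀ a b : ConvSeries, g = a * b → substHom γ a = 0 → IsUnit b := by
      intro a b hab ha
      obtain ⟨c, rfl⟩ := hdvd a ha
      refine IsUnit.of_mul_eq_one c (mul_left_cancel₀ hg0 ?_)
      rw [mul_one]
      conv_rhs => rw [hab]
      ring
    intro a b hab
    have h1 := hroot
    rw [hab, map_mul] at h1
    rcases mul_eq_zero.1 h1 with h | h
    · exact Or.inr (key a b hab h)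
    · exact Or.inl (key b a (by rw [hab, mul_comm]) h)
  · intro δ hδ
    rw [hsubst, Finset.prod_eq_zero_iff] at hδ
    obtain ⟨ε, hε, h⟩ := hδ
    obtain ⟨k, rfl⟩ := (hmem ε).1 hε
    exact ⟨k, Subtype.ext (sub_eq_zero.1 h)⟩

/-- The roots of an irreducible convergent power series are conjugate. -/
theorem exists_conj_eq {p : ConvSeries} (hp : Irreducible p) {γ δ : FracSeries} (hγ : γ ∈ Zer p)
    (hδ : δ ∈ Zer p) : ∃ k, δ = γ.conj k := by
  obtain ⟨g, hg, -, hdvd, hconj⟩ := exists_irreducible γ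
  obtain ⟨u, rfl⟩ := hdvd p hγ
  have hu : IsUnit u := (hp.isUnit_or_isUnit rfl).resolve_left hg.not_isUnit
  refine hconj δ ?_
  have h1 := mem_Zer.1 hδ
  rw [map_mul] at h1
  exact (mul_eq_zero.1 h1).resolve_right (hu.map (substHom δ)).ne_zero

/-! ### Critical values of polynomials -/

/-- A nonconstant polynomial has fewer nonzero critical values than distinct roots. -/
theorem encard_criticalValues_add_one_le {G : ℂ[X]} (hG : 0 < G.natDegree) :
    (criticalValues G \ {0}).encard + 1 ≤ (G.roots.toFinset.card : ℕ∞) := by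
  classical
  have hG0 : G ≠ 0 := by
    rintro rfl
    simp at hG
  set D := G.derivative.roots.toFinset \ G.roots.toFinset with hD
  have hG' : G.derivative ≠ 0 := by
    intro h
    exact hG.ne' (derivative_eq_zero.1 h)
  have hsub : criticalValues G \ {0} ⊆ (fun z => G.eval z) '' (D : Set ℂ) := by
    rintro w ⟨⟨z, hz, rfl⟩, hw⟩
    refine ⟨z, ?_, rfl⟩
    rw [hD, Finset.mem_coe, Finset.mem_sdiff, Multiset.mem_toFinset, Multiset.mem_toFinset,
      mem_roots hG', mem_roots hG0]
    exact ⟨hz, hw⟩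
  -- Differentiation lowers each root multiplicity by one. Of the at most `deg G - 1` zeros of `G'`,
  -- exactly `deg G` minus the number `r` of distinct roots of `G` lie on roots of `G`, leaving at
  -- most `r - 1` elsewhere.
  have hcard : D.card + 1 ≤ G.roots.toFinset.card := by
    have h1 : ∑ x ∈ G.derivative.roots.toFinset ∪ G.roots.toFinset,
        G.derivative.roots.count x = G.derivative.roots.card :=
      Multiset.sum_count_eq_card fun x hx =>
        Finset.mem_union_left _ (Multiset.mem_toFinset.2 hx)
    have h2 : ∑ x ∈ G.roots.toFinset, G.roots.count x = G.natDegree := by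
      rw [Multiset.toFinset_sum_count_eq]
      exact (IsAlgClosed.splits G).natDegree_eq_card_roots.symm
    have h3 : G.derivative.roots.card ≤ G.natDegree - 1 :=
      (card_roots' _).trans (natDegree_derivative_le G)
    have h4 : D.card ≤ ∑ x ∈ D, G.derivative.roots.count x := by
      rw [Finset.card_eq_sum_ones]
      refine Finset.sum_le_sum fun x hx => ?_
      exact Multiset.one_le_count_iff_mem.2
        (Multiset.mem_toFinset.1 (Finset.mem_sdiff.1 hx).1)
    have h5 : ∑ x ∈ G.roots.toFinset, G.roots.count x =
        ∑ x ∈ G.roots.toFinset, G.derivative.roots.count x + G.roots.toFinset.card := by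
      rw [Finset.card_eq_sum_ones, ← Finset.sum_add_distrib]
      refine Finset.sum_congr rfl fun x hx => ?_
      have hx' := Multiset.mem_toFinset.1 hx
      have h6 : 1 ≤ G.rootMultiplicity x := by
        rw [← count_roots]
        exact Multiset.one_le_count_iff_mem.2 hx'
      rw [count_roots, count_roots, derivative_rootMultiplicity_of_root ((mem_roots hG0).1 hx')]
      omega
    rw [← Finset.sdiff_union_self_eq_union, Finset.sum_union Finset.sdiff_disjoint, ← hD] at h1
    omega
  calc (criticalValues G \ {0}).encard + 1 ≤ (D : Set ℂ).encard + 1 := 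
        add_le_add_left ((Set.encard_le_encard hsub).trans (Set.encard_image_le _ _)) 1
    _ = ((D.card + 1 : ℕ) : ℕ∞) := by rw [Set.encard_coe_eq_coe_finsetCard]; rfl
    _ ≤ _ := by exact_mod_cast hcard

/-- The derivative is `n z ^ (n - 1) G'(z ^ n)`: a critical point is either `0` or has its `n`-th
power critical for `G`. -/
theorem criticalValues_expand_subset (n : ℕ) (hn : 0 < n) (G : ℂ[X]) :
    criticalValues (expand ℂ n G) ⊆ insert (G.eval 0) (criticalValues G) := by
  rintro w ⟨z, hz, rfl⟩
  rw [expand_eval]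
  rcases eq_or_ne z 0 with rfl | hz0
  · left
    rw [zero_pow hn.ne']
  · right
    refine ⟨z ^ n, ?_, rfl⟩
    rw [derivative_expand, eval_mul, expand_eval] at hz
    refine (mul_eq_zero.1 hz).resolve_right ?_
    simp [hn.ne', hz0]

/-- Comparing coefficients, `ω ^ i = 1` whenever `X ^ i` occurs in `F`, so only multiples of the
order of `ω` occur. -/
theorem exists_eq_expand {F : ℂ[X]} {ω : ℂ} (hω : 0 < orderOf ω)
    (hF : ∀ z, F.eval (ω * z) = F.eval z) : ∃ G : ℂ[X], F = expand ℂ (orderOf ω) G := by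
  refine ⟨contract (orderOf ω) F, ?_⟩
  have h1 : F.comp (C ω * X) = F := Polynomial.funext fun z => by simp [hF]
  ext i
  rw [coeff_expand hω, coeff_contract hω.ne']
  split_ifs with h
  · rw [Nat.div_mul_cancel h]
  · have h2 := congrArg (fun p : ℂ[X] => p.coeff i) h1
    simp only [comp_C_mul_X_coeff] at h2
    by_contra h3
    exact h (orderOf_dvd_of_pow_eq_one (mul_left_cancel₀ h3 (by rw [h2, mul_one])))

/-! ### The tree-model -/

theorem contact_comm (α β : FracSeries) : contact α β = contact β α := by
  rw [contact, contact, ← HahnSeries.orderTop_neg, neg_sub]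

theorem contact_self (α : FracSeries) : contact α α = ⊤ := by simp [contact]

theorem min_contact_le (α β γ : FracSeries) :
    min (contact α β) (contact β γ) ≤ contact α γ := by
  have h : α.1 - γ.1 = (α.1 - β.1) + (β.1 - γ.1) := by ring
  rw [contact, contact, contact, h]
  exact HahnSeries.min_orderTop_le_orderTop_add

theorem treeModel_spec {f : ConvSeries} {B : PseudoBall} (hB : B ∈ treeModel f) :
    ∃ α ∈ Zer f, ∃ β ∈ Zer f, α ∈ B.carrier ∧ β ∈ B.carrier ∧ contact α β = B.height := by
  obtain ⟨α, hα, β, hβ, rfl⟩ := hB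
  refine ⟨α, hα, β, hβ, ?_, ?_, rfl⟩
  · change contact α β ≤ contact α α
    rw [contact_self]
    exact le_top
  · change contact α β ≤ contact β α
    rw [contact_comm]

theorem finite_treeModel (f : ConvSeries) (hf : (restrictX f).order < ⊤) :
    (treeModel f).Finite := by
  refine ((finite_Zer f hf).image2 (fun α β => ball α (contact α β) (contact_pos α β))
    (finite_Zer f hf)).subset ?_
  rintro _ ⟨α, hα, β, hβ, rfl⟩
  exact ⟨α, hα, β, hβ, rfl⟩

theorem conj_self {f : ConvSeries} {B : PseudoBall} (hB : B ∈ treeModel f) : Conj B B := by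
  obtain ⟨α, -, -, -, hαB, -, -⟩ := treeModel_spec hB
  obtain ⟨g, hg, hα, -, -⟩ := exists_irreducible α
  exact ⟨rfl, g, hg, ⟨α, hα, hαB⟩, ⟨α, hα, hαB⟩⟩

/-- Every Newton-Puiseux root of `f` in a vertex of finite height lies in a child of it. -/
theorem exists_child {f : ConvSeries} (hf : (restrictX f).order < ⊤) {B : PseudoBall}
    (hB : B ∈ treeModel f) (hfin : B.height ≠ ⊤) {γ : FracSeries} (hγ : γ ∈ Zer f)
    (hγB : γ ∈ B.carrier) :
    ∃ B', IsChild f B B' ∧ γ ∈ B'.carrier ∧ B.height < B'.height := by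
  have hlt_top : B.height < ⊤ := lt_top_iff_ne_top.2 hfin
  -- Among the roots closer to `γ` than the height of `B`, one of least contact is chosen. The
  -- candidate `γ` itself, of contact `⊤`, makes the set nonempty and allows a child of infinite
  -- height.
  obtain ⟨β, ⟨hβ, hβh⟩, hmin⟩ := Set.exists_min_image {β ∈ Zer f | B.height < contact γ β}
    (fun β => contact γ β) ((finite_Zer f hf).subset fun _ h => h.1)
    ⟨γ, hγ, by rwa [contact_self]⟩
  have hγB' : γ ∈ (ball γ (contact γ β) (contact_pos γ β)).carrier := by
    change contact γ β ≤ contact γ γ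
    rw [contact_self]
    exact le_top
  refine ⟨ball γ (contact γ β) (contact_pos γ β),
    ⟨hB, ⟨γ, hγ, β, hβ, rfl⟩, ⟨?_, ?_⟩, ?_⟩, hγB', hβh⟩
  · intro δ hδ
    exact (PseudoBall.mem_carrier_iff hγB).2 (hβh.le.trans hδ)
  -- Otherwise the two roots of `f` whose contact is exactly the height of `B` would be closer than
  -- that.
  · intro hsub
    obtain ⟨α₁, -, α₂, -, h1, h2, h3⟩ := treeModel_spec hB
    have h4 : contact γ β ≤ contact α₁ γ := hsub h1
    have h5 : contact γ β ≤ contact α₂ γ := hsub h2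
    have h6 := (le_min h4 (h5.trans_eq (contact_comm _ _))).trans (min_contact_le α₁ γ α₂)
    rw [h3] at h6
    exact absurd hβh (not_lt.2 h6)
  · rintro ⟨A, hA, hA1, hA2⟩
    have hγA : γ ∈ A.carrier := hA1.1 hγB'
    have hAh : B.height < A.height := by
      by_contra! hle
      refine hA2.2 fun δ hδ => (PseudoBall.mem_carrier_iff hγA).2 ?_
      exact hle.trans ((PseudoBall.mem_carrier_iff hγB).1 hδ)
    -- If all roots in `A` were closer to `γ` than the height of `A`, the two roots realizing that
    -- height would be too close. Minimality of `β` applied to `ε` then puts `A` inside the new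
    -- ball.
    obtain ⟨ε, hε, hεA, hε1⟩ : ∃ ε ∈ Zer f, ε ∈ A.carrier ∧ contact γ ε ≤ A.height := by
      obtain ⟨α₁, hα₁, α₂, hα₂, h1, h2, h3⟩ := treeModel_spec hA
      by_contra! hcon
      have h4 := hcon α₁ hα₁ h1
      have h5 := hcon α₂ hα₂ h2
      rw [contact_comm] at h4
      exact absurd ((lt_min h4 h5).trans_le (min_contact_le α₁ γ α₂)) (by rw [h3]; exact lt_irrefl _)
    have h1 : contact γ β ≤ contact γ ε := by
      refine hmin ε ⟨hε, hAh.trans_le ?_⟩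
      rw [contact_comm]
      exact (PseudoBall.mem_carrier_iff hγA).1 hεA
    refine hA1.2 fun δ hδ => ?_
    exact (h1.trans hε1).trans ((PseudoBall.mem_carrier_iff hγA).1 hδ)

/-! ### Conjugation and the polynomial `F_B` -/

theorem PseudoBall.coeff_lam {B : PseudoBall} {h : ℚ} (hB : B.height = h) {γ : FracSeries}
    (hγ : γ ∈ B.carrier) (e : ℚ) : B.lam.coeff e = if e < h then γ.1.coeff e else 0 := by
  have hu : B.height.untopD 0 = h := by rw [hB]; rfl
  rw [PseudoBall.lam, HahnSeries.coeff_truncLT, hu]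
  split_ifs with he
  · exact PseudoBall.coeff_eq hγ B.center_mem (by rw [hB]; exact_mod_cast he)
  · rfl

theorem PseudoBall.lc_conj {B : PseudoBall} {h : ℚ} (hB : B.height = h) (γ : FracSeries) (k : ℤ) :
    B.lc (γ.conj k) = chi k h * B.lc γ := by
  rw [PseudoBall.lc, PseudoBall.lc, hB]
  rfl

/-- Membership in `B` depends only on the terms below `y ^ h`, and for members these are `λ_B`. So
whether conjugation by `k` keeps a member in `B` does not depend on the member. -/
theorem PseudoBall.conj_mem_iff {B : PseudoBall} {h : ℚ} (hB : B.height = h) {γ : FracSeries}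
    (hγ : γ ∈ B.carrier) (k : ℤ) : γ.conj k ∈ B.carrier ↔ conjHom k B.lam = B.lam := by
  rw [PseudoBall.mem_carrier_iff hγ, hB, contact, le_orderTop_iff, HahnSeries.ext_iff, funext_iff]
  refine forall_congr' fun e => ?_
  rw [coeff_conjHom, PseudoBall.coeff_lam hB hγ, HahnSeries.coeff_sub, sub_eq_zero]
  split_ifs with he
  · simp only [WithTop.coe_lt_coe, he, true_imp_iff]
    rfl
  · simp [he]

/-- For a pseudo-ball of finite height, the conjugations which preserve it act on leading
coefficients by the powers of a root of unity. -/
theorem PseudoBall.exists_rootOfUnity (B : PseudoBall) (h : ℚ) :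
    ∃ N : ℤ, 0 < orderOf (chi N h) ∧ conjHom N B.lam = B.lam ∧
      ∀ k, conjHom k B.lam = B.lam → chi k h ^ orderOf (chi N h) = 1 := by
  have hchi : ∀ (N : ℤ) (j : ℕ), chi (N * j) h = chi N h ^ j := by
    intro N j
    rw [chi, chi, ← Complex.exp_nat_mul]
    congr 1
    push_cast
    ring
  -- The stabilizer of `λ_B` in `ℤ` is cyclic, and a generator serves as `N`. The root of unity it
  -- defines has finite order because `h` is rational.
  let H : AddSubgroup ℤ :=
    { carrier := {k | conjHom k B.lam = B.lam}
      zero_mem' := conjHom_zero _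
      add_mem' := by
        intro a b ha hb
        change conjHom (a + b) B.lam = B.lam
        rw [← conjHom_conjHom, hb, ha]
      neg_mem' := by
        intro a ha
        have ha' : conjHom a B.lam = B.lam := ha
        change conjHom (-a) B.lam = B.lam
        conv_lhs => rw [← ha']
        rw [conjHom_conjHom, neg_add_cancel, conjHom_zero] }
  obtain ⟨N, hN⟩ := Int.subgroup_cyclic H
  have hNH : N ∈ H := by
    rw [hN]
    exact AddSubgroup.subset_closure rfl
  refine ⟨N, ?_, hNH, fun k hk => ?_⟩
  · refine orderOf_pos_iff.2 (isOfFinOrder_iff_pow_eq_one.2 ⟨h.den, h.den_pos, ?_⟩)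
    rw [← hchi, chi_eq_one_iff]
    refine ⟨N * h.num, ?_⟩
    push_cast
    rw [mul_assoc, Rat.den_mul_eq_num]
  · have hkH : k ∈ H := hk
    rw [hN, AddSubgroup.mem_closure_singleton] at hkH
    obtain ⟨j, rfl⟩ := hkH
    rw [← hchi]
    have h1 : chi N h ^ orderOf (chi N h) = 1 := pow_orderOf_eq_one _
    rw [← hchi, chi_eq_one_iff] at h1
    rw [chi_eq_one_iff]
    obtain ⟨m, hm⟩ := h1
    refine ⟨j * m, ?_⟩
    push_cast at hm ⊢
    rw [← hm, smul_eq_mul]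
    push_cast
    ring

/-- Conjugating `γ = λ_B + z y ^ h + ⋯` multiplies `z` by `chi N h`, while the coefficient of `y ^
q` in `f(γ(y), y)` is multiplied by `exp (2πi N q) = 1`. This is where integrality of `q(B)`, rather
than its finiteness, matters. -/
theorem FPoly_eval_mul {f : ConvSeries} (hf : (restrictX f).order < ⊤) {B : PseudoBall} {h : ℚ}
    (hB : B.height = h) {m : ℤ} (hq : qExp f B = ((m : ℚ) : WithTop ℚ)) {N : ℤ}
    (hN : conjHom N B.lam = B.lam) (z : ℂ) :
    (FPoly f B).eval (chi N h * z) = (FPoly f B).eval z := by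
  obtain ⟨q, hq', -, hstart⟩ := startsWith_subst f hf B (by rw [hB]; exact WithTop.coe_ne_top)
  have hqm : q = m := by
    rw [hq] at hq'
    exact_mod_cast hq'.symm
  obtain ⟨γ, hγ, hlc, -⟩ := PseudoBall.exists_mem_lc_eq hB z
  have h1 := (hstart γ hγ).2
  have h2 := (hstart _ ((PseudoBall.conj_mem_iff hB hγ N).2 hN)).2
  rw [PseudoBall.lc_conj hB, hlc] at h2
  rw [hlc] at h1
  rw [← h1, ← h2, ← substHom_apply, substHom_conj, coeff_conjHom, substHom_apply, hqm,
    (chi_eq_one_iff N m).2 ⟨N * m, by push_cast; ring⟩, one_mul]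

/-! ### The bound on critical values -/

theorem encard_criticalValues_FPoly_le (f : ConvSeries) (hf : (restrictX f).order < ⊤)
    (B : PseudoBall) (hB : B ∈ treeModel f)
    (hq : ∃ m : ℤ, qExp f B = ((m : ℚ) : WithTop ℚ)) :
    (criticalValues (FPoly f B) \ {0}).encard ≤ (numChildren f (conjClass f B) : ℕ∞) := by
  classical
  obtain ⟨m, hq⟩ := hq
  have hfin : B.height ≠ ⊤ := by
    intro h
    rw [qExp, if_pos h] at hq
    exact WithTop.top_ne_coe hq
  obtain ⟨h, hh⟩ := WithTop.ne_top_iff_exists.1 hfin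
  have hh := hh.symm
  obtain ⟨N, hn, hN, hstab⟩ := B.exists_rootOfUnity h
  obtain ⟨G, hG⟩ := exists_eq_expand hn (FPoly_eval_mul hf hh hq hN)
  set n := orderOf (chi N h) with hn_def
  obtain ⟨q, -, hF0, hstart⟩ := startsWith_subst f hf B hfin
  -- The pseudo-ball contains a root of `f`, so the nonzero polynomial `F_B` has a zero and is not
  -- constant.
  have hGdeg : 0 < G.natDegree := by
    obtain ⟨α, hα, -, -, hαB, -, -⟩ := treeModel_spec hB
    have h1 : (FPoly f B).eval (B.lc α) = 0 := by
      rw [← (hstart α hαB).2, ← substHom_apply, mem_Zer.1 hα]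
      rfl
    have h2 : 0 < (FPoly f B).natDegree := by
      refine Nat.pos_of_ne_zero fun h0 => hF0 ?_
      rw [eq_C_of_natDegree_eq_zero h0, eval_C] at h1
      rw [eq_C_of_natDegree_eq_zero h0, h1, C_0]
    rw [hG, natDegree_expand] at h2
    exact Nat.pos_of_mul_pos_right h2
  have hG0 : G ≠ 0 := by
    rintro rfl
    simp at hGdeg
  have hchild : ∀ s ∈ G.roots.toFinset, ∃ B', IsChild f B B' ∧ ∃ γ ∈ B'.carrier,
      γ ∈ B.carrier ∧ B.height < B'.height ∧ B.lc γ ^ n = s := by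
    intro s hs
    obtain ⟨z, hz⟩ := IsAlgClosed.exists_pow_nat_eq s hn
    have hz0 : (FPoly f B).eval z = 0 := by
      rw [hG, expand_eval, hz]
      exact (mem_roots hG0).1 (Multiset.mem_toFinset.1 hs)
    obtain ⟨γ, hγ, hγB, hlc⟩ := exists_mem_Zer_lc_eq f hf hh hz0
    obtain ⟨B', hB', hγB', hlt⟩ := exists_child hf hB hfin hγ hγB
    exact ⟨B', hB', γ, hγB', hγB, hlt, by rw [hlc, hz]⟩
  have : Nonempty PseudoBall := ⟨B⟩
  have : Nonempty FracSeries := ⟨B.center⟩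
  choose! ch hch γ hγ using hchild
  have hcard : G.roots.toFinset.card ≤ numChildren f (conjClass f B) := by
    rw [← Set.ncard_coe_finset, numChildren]
    refine Set.ncard_le_ncard_of_injOn (fun s => conjClass f (ch s)) ?_ ?_ ?_
    · intro s hs
      have h1 := hch s hs
      exact ⟨⟨B, hB, rfl⟩, ⟨ch s, h1.2.1, rfl⟩, B, ⟨hB, conj_self hB⟩, ch s,
        ⟨h1.2.1, conj_self h1.2.1⟩, h1⟩
    · intro s hs t ht hst
      obtain ⟨hγs, hγsB, hlts, hlcs⟩ := hγ s hs
      obtain ⟨hγt, hγtB, hltt, hlct⟩ := hγ t ht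
      have h1 : ch t ∈ conjClass f (ch s) := by
        have h2 : ch t ∈ conjClass f (ch t) := ⟨(hch t ht).2.1, conj_self (hch t ht).2.1⟩
        exact (show conjClass f (ch s) = conjClass f (ch t) from hst) ▸ h2
      obtain ⟨-, -, p, hp, ⟨δ, hδ, hδs⟩, ε, hε, hεt⟩ := h1
      obtain ⟨k, rfl⟩ := exists_conj_eq hp hδ hε
      -- A child has height above `h`, so its members share the coefficient of `y ^ h`. The roots of
      -- `p` may thus replace the chosen roots of `f` when leading coefficients are compared.
      have hlc : ∀ {r α β}, B.height < (ch r).height → α ∈ (ch r).carrier →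
          β ∈ (ch r).carrier → B.lc α = B.lc β := by
        intro r α β hlt hα hβ
        rw [PseudoBall.lc, PseudoBall.lc, hh]
        refine PseudoBall.coeff_eq hβ hα ?_
        change (h : WithTop ℚ) < _
        rw [← hh]
        exact hlt
      have hk := (PseudoBall.conj_mem_iff hh ((hch s hs).2.2.1.1 hδs) k).1 ((hch t ht).2.2.1.1 hεt)
      rw [← hlcs, ← hlct, hlc hlts hγs hδs, hlc hltt hγt hεt, PseudoBall.lc_conj hh, mul_pow,
        hstab k hk, one_mul]
    -- Finiteness is needed because `ncard` of an infinite set is `0`.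
    · refine ((finite_treeModel f hf).image (conjClass f)).subset ?_
      rintro c ⟨-, hc, -⟩
      exact hc
  -- The possible additional value `G(0)` is paid for by the one spare root in the count for `G`.
  calc (criticalValues (FPoly f B) \ {0}).encard
      ≤ (insert (G.eval 0) (criticalValues G \ {0})).encard := by
        refine Set.encard_le_encard ?_
        rintro w ⟨hw, hw0⟩
        rw [hG] at hw
        exact (criticalValues_expand_subset n hn G hw).imp id fun h => ⟨h, hw0⟩
    _ ≤ (criticalValues G \ {0}).encard + 1 := Set.encard_insert_le _ _
    _ ≤ (G.roots.toFinset.card : ℕ∞) := encard_criticalValues_add_one_le hGdeg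
    _ ≤ _ := by exact_mod_cast hcard

end KuoLu

end

theorem mainTheorem6 (f : KuoLu.ConvSeries)
    (hf_pos : 0 < (KuoLu.restrictX f).order) (hf_fin : (KuoLu.restrictX f).order < ⊤)
    (B : KuoLu.PseudoBall) (hB : B ∈ KuoLu.treeModel f)
    (hq : ∃ m : ℤ, KuoLu.qExp f B = ((m : ℚ) : WithTop ℚ)) :
    (KuoLu.criticalValues (KuoLu.FPoly f B) \ {0}).encard ≤
      (KuoLu.numChildren f (KuoLu.conjClass f B) : ℕ∞) := by
  exact KuoLu.encard_criticalValues_FPoly_le f hf_fin B hB hq
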